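/- Let $n\ge 2$, let $I\subseteq(0,\infty)$ be an open interval, and let $V:I\to\mathbb{R}$ be smooth and positive. Let $\mathfrak{c}_{n-1}$ be the complex hyperbolic metric of constant holomorphic sectional curvature $-4$ on $\mathbb{CH}^{n-1}$, realized as the unit ball $\{\zeta\in\mathbb{C}^{n-1}:\|\zeta\|<1\}$, $$\mathfrak{c}_{n-1}=\frac{\operatorname{Re}\langle d\zeta,d\zeta\rangle}{1-\|\zeta\|^2}+\frac{|\langle\zeta,d\zeta\rangle|^2}{(1-\|\zeta\|^2)^2},$$ where $\langle\cdot,\cdot\rangle$ is the Hermitian product, conjugate-linear in the first variable. On $\mathbb{CH}^{n-1}\times S^1\times I$, with coordinates $(\zeta,e^{i\vartheta},u)$, consider the Riemannian metric $$\lambda=u^2\,\mathfrak{c}_{n-1}+u^2V(u)\,d\theta^2+\frac{1}{V(u)}\,du^2,$$ where $d\theta$ denotes the (non-closed) connection $1$-form $$d\theta=d\vartheta+\frac{\operatorname{Im}\langle\zeta,d\zeta\rangle}{1-\|\zeta\|^2}.$$ (For $I=(1,\infty)$ and $V(u)=u^2-1$, $\lambda$ is the complex hyperbolic metric $\mathfrak{c}_n$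 on $\mathbb{CH}^n\setminus\mathbb{CH}^{n-1}$ in polar coordinates about a totally geodesic $\mathbb{CH}^{n-1}$, with $u=\cosh r$ and $r$ the distance to $\mathbb{CH}^{n-1}$; the kernel of $d\theta$ and $du$ is the $\mathfrak{c}_n$-orthogonal complement of the fibres of the orthogonal projection $\mathbb{CH}^n\to\mathbb{CH}^{n-1}$.) Then $\lambda$ is Einstein with Einstein constant $-2(n+1)$, that is, $\mathrm{Ric}=-2(n+1)\,\lambda$ at every point, if and only if there is a constant $\alpha\in\mathbb{R}$ such that $$V(u)=u^2-1+\frac{\alpha}{u^{2n}}\qquad\text{for all }u\in I.$$ -/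

import Mathlib

/-!
# Riemannian curvature on a finite-dimensional real vector space, and the metric `λ`

A (pseudo-)Riemannian metric on an open subset of a real vector space `E` is written as a function
`g : E → E → E → ℝ`, where `g x v w` is the product at the point `x` of the tangent vectors
`v, w ∈ T_x E = E`.
-/

noncomputable section

namespace CHPolar

section Curvature

variable {E : Type*} [NormedAddCommGroup E] [NormedSpace ℝ E]

/-- The right-hand side of the Koszul formula for constant vector fields `v, w, z` (which commute):
`g(∇_v w, z) = ½ (v·g(w,z) + w·g(v,z) - z·g(v,w))`, the Christoffel symbols of the first kind. -/
def koszul (g : E → E → E → ℝ) (x v w z : E) : ℝ :=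
  (1 / 2) * (fderiv ℝ (fun y => g y w z) x v + fderiv ℝ (fun y => g y v z) x w
    - fderiv ℝ (fun y => g y v w) x z)

/-- The Christoffel symbols of the second kind: `christoffel g x v w` is `∇_v w` at `x`, for the
Levi-Civita connection `∇` of `g` and constant vector fields `v, w`. It is the vector `c` with
`g(c, z) = koszul g x v w z` for all `z`; there is exactly one, as long as `g x` is a nondegenerate
bilinear form and `g` is differentiable at `x`. -/
def christoffel (g : E → E → E → ℝ) (x v w : E) : E :=
  Classical.epsilon fun c : E => ∀ z : E, g x c z = koszul g x v w z

/-- The Riemann curvature tensor `R(v,w)z = ∇_v ∇_w z - ∇_w ∇_v z - ∇_[v,w] z` at `x`, evaluated on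
constant vector fields (for which `[v,w] = 0`). -/
def riemann (g : E → E → E → ℝ) (x v w z : E) : E :=
  fderiv ℝ (fun y => christoffel g y w z) x v - fderiv ℝ (fun y => christoffel g y v z) x w
    + christoffel g x v (christoffel g x w z) - christoffel g x w (christoffel g x v z)

/-- The Ricci tensor `Ric(a,b)` at `x`: the trace of the endomorphism `z ↦ R(z,a)b`, computed in a
basis of `E` (the trace does not depend on the basis). In a `g`-orthonormal basis `Yᵢ` of the
tangent space it is `∑ g(R(Yᵢ,a)b, Yᵢ)`, and it is negative for hyperbolic metrics. -/
def ricci [FiniteDimensional ℝ E] (g : E → E → E → ℝ) (x a b : E) : ℝ :=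
  ∑ i, (Module.finBasis ℝ E).repr (riemann g x (Module.finBasis ℝ E i) a b) i

/-- The metric `g` on the open set `U` is Einstein with Einstein constant `C`. -/
def IsEinsteinOn [FiniteDimensional ℝ E] (g : E → E → E → ℝ) (U : Set E) (C : ℝ) : Prop :=
  ∀ x ∈ U, ∀ a b : E, ricci g x a b = C * g x a b

end Curvature

/-- The complex hyperbolic metric of constant holomorphic sectional curvature `-4`, in the ball
model `{z : ‖z‖ < 1}` inside a complex inner product space `F`:
`Re⟪v,w⟫ / (1 - ‖z‖²) + Re (⟪v,z⟫ ⟪z,w⟫) / (1 - ‖z‖²)²`.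
With `F = ℂᵐ` this is the metric `𝔠ₘ` of complex hyperbolic space `ℂℍᵐ`. -/
def chMetric {F : Type*} [NormedAddCommGroup F] [InnerProductSpace ℂ F] (z v w : F) : ℝ :=
  (inner ℂ v w).re / (1 - ‖z‖ ^ 2) + (inner ℂ v z * inner ℂ z w).re / (1 - ‖z‖ ^ 2) ^ 2

/-- The real vector space (of real dimension `2n` if `n ≥ 1`) that contains the manifold on which
the metric `λ` lives: a point is `(ζ, y)` with `ζ ∈ ℂⁿ⁻¹` and `y = u e^{iθ} ∈ ℂ`. -/
abbrev Space (n : ℕ) : Type := EuclideanSpace ℂ (Fin (n - 1)) × ℂ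

/-- The manifold `ℂℍⁿ⁻¹ × S¹ × I` for a set `I` of positive real numbers. The point
`(ζ, e^{iθ}, u)`, with `ζ` in the unit ball model of `ℂℍⁿ⁻¹`, is written as `(ζ, u e^{iθ})`. -/
def polarDomain (n : ℕ) (I : Set ℝ) : Set (Space n) :=
  {x | ‖x.1‖ < 1 ∧ ‖x.2‖ ∈ I}

/-- The differential `du` of the radial coordinate `u = |y|`. -/
def du {n : ℕ} (x v : Space n) : ℝ :=
  ((starRingEnd ℂ) x.2 * v.2).re / ‖x.2‖

/-- The form called `dθ` in `𝔠ₙ = u² 𝔠ₙ₋₁ + u² (u² - 1) dθ² + du² / (u² - 1)`. It is the form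
of the coframe dual to the frame `(Xᵢ), ∂/∂θ, ∂/∂u`: it is `1` on `∂/∂θ` and vanishes on `∂/∂u` and
on the horizontal distribution `ℋ`. The latter is not integrable, and `dθ` is not the differential
of the angle `arg y` (the first summand) but a connection form; the second summand is fixed
by `ℋ` being the `𝔠ₙ`-orthogonal complement of the fibres of the orthogonal projection
`ℂℍⁿ → ℂℍⁿ⁻¹`; see `chMetric_polar`. -/
def dtheta {n : ℕ} (x v : Space n) : ℝ :=
  ((starRingEnd ℂ) x.2 * v.2).im / ‖x.2‖ ^ 2 + (inner ℂ x.1 v.1).im / (1 - ‖x.1‖ ^ 2)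

/-- The metric `λ = u² 𝔠ₙ₋₁ + u² V(u) dθ² + du² / V(u)`. -/
def lam {n : ℕ} (V : ℝ → ℝ) (x v w : Space n) : ℝ :=
  ‖x.2‖ ^ 2 * chMetric x.1 v.1 w.1
    + ‖x.2‖ ^ 2 * V ‖x.2‖ * (dtheta x v * dtheta x w)
    + (du x v * du x w) / V ‖x.2‖

/-- The inverse of the polar coordinates `(ζ, θ, u)` of `ℂℍⁿ` (in the ball model, whose points are
written `(ζ, w)` with `ζ ∈ ℂⁿ⁻¹` and `w ∈ ℂ`) about the hyperplane `ℂℍⁿ⁻¹ = {w = 0}`: the orthogonal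
projection to the hyperplane is `(ζ, w) ↦ ζ`, the angle is `θ = arg w`, and `u = cosh r`, for `r` the
distance to the hyperplane, satisfies `u² = (1 - ‖ζ‖²) / (1 - ‖ζ‖² - |w|²)`. -/
def polarMap {n : ℕ} (x : Space n) : WithLp 2 (EuclideanSpace ℂ (Fin (n - 1)) × ℂ) :=
  WithLp.toLp 2
    (x.1, ((√((1 - ‖x.1‖ ^ 2) * (‖x.2‖ ^ 2 - 1)) / ‖x.2‖ ^ 2 : ℝ) : ℂ) * x.2)

/-- Consistency of the definitions: in polar coordinates about `ℂℍⁿ⁻¹`, the complex hyperbolic metric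
`𝔠ₙ` is `λ` for the function `V(u) = u² - 1`, on `u > 1`. -/
theorem chMetric_polar {n : ℕ} (x v w : Space n) (hx : x ∈ polarDomain n (Set.Ioi 1)) :
    chMetric (polarMap x) (fderiv ℝ polarMap x v) (fderiv ℝ polarMap x w)
      = lam (fun u => u ^ 2 - 1) x v w := by
  obtain ⟨h1, h2⟩ := hx
  have hu1 : 1 < ‖x.2‖ := h2
  have hu0 : 0 < ‖x.2‖ := by linarith
  have hy : x.2 ≠ 0 := norm_pos_iff.1 hu0
  have hs : 0 < 1 - ‖x.1‖ ^ 2 := by nlinarith [norm_nonneg x.1]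
  have hu2 : 0 < ‖x.2‖ ^ 2 - 1 := by nlinarith
  set s := 1 - ‖x.1‖ ^ 2 with hsdef
  set u := ‖x.2‖ with hudef
  set c : ℝ := √(s * (u ^ 2 - 1)) / u ^ 2 with hc
  have hsq : √(s * (u ^ 2 - 1)) ^ 2 = s * (u ^ 2 - 1) := Real.sq_sqrt (by positivity)
  have hsqpos : 0 < √(s * (u ^ 2 - 1)) := Real.sqrt_pos.2 (by positivity)
  have hc2 : c ^ 2 = s * (u ^ 2 - 1) / u ^ 4 := by
    rw [hc, div_pow, hsq]; ring
  have hdu : ∀ v : Space n, ((starRingEnd ℂ) x.2 * v.2).re = u * du x v := by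
    intro v; rw [du, ← hudef]; field_simp
  have hns : ∀ (F : Type) [NormedAddCommGroup F] [InnerProductSpace ℂ F] (a b : F),
      HasDerivAt (fun t : ℝ => ‖a + t • b‖ ^ 2) (2 * (inner ℂ a b).re) 0 := by
    intro F _ _ a b
    have h : ∀ t : ℝ, ‖a + t • b‖ ^ 2 = ‖a‖ ^ 2 + t * (2 * (inner ℂ a b).re) + t ^ 2 * ‖b‖ ^ 2 := by
      intro t
      rw [show t • b = (t : ℂ) • b from (Complex.coe_smul t b).symm, @norm_add_sq ℂ, norm_smul,
        inner_smul_right, mul_pow]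
      simp
      ring
    rw [funext h]
    have h1 := ((hasDerivAt_id (0 : ℝ)).mul_const (2 * (inner ℂ a b).re)).const_add (‖a‖ ^ 2)
    have h2 := ((hasDerivAt_id (0 : ℝ)).pow 2).mul_const (‖b‖ ^ 2)
    refine (h1.add h2).congr_deriv ?_
    simp
  have hder : ∀ v : Space n, fderiv ℝ (polarMap (n := n)) x v = WithLp.toLp 2
      (v.1, (c : ℂ) * (((-(inner ℂ x.1 v.1).re / s + du x v / (u * (u ^ 2 - 1)) - du x v / u : ℝ) : ℂ)
        * x.2 + v.2)) := by
    intro v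
    set q : Space n → ℝ := fun x => √((1 - ‖x.1‖ ^ 2) * (‖x.2‖ ^ 2 - 1)) / ‖x.2‖ ^ 2 with hq
    set f : Space n → Space n := fun x => (x.1, ((q x : ℝ) : ℂ) * x.2) with hf
    have hpf : polarMap (n := n)
        = (WithLp.prodContinuousLinearEquiv 2 ℝ (EuclideanSpace ℂ (Fin (n - 1))) ℂ).symm ∘ f := rfl
    rw [hpf, ContinuousLinearEquiv.comp_fderiv]
    change WithLp.toLp 2 (fderiv ℝ f x v) = _
    congr 1
    have hn1 : DifferentiableAt ℝ (fun x : Space n => ‖x.1‖ ^ 2) x :=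
      DifferentiableAt.norm_sq ℂ differentiableAt_fst
    have hn2 : DifferentiableAt ℝ (fun x : Space n => ‖x.2‖ ^ 2) x :=
      DifferentiableAt.norm_sq ℂ differentiableAt_snd
    have hr1 : DifferentiableAt ℝ (fun x : Space n => (1 - ‖x.1‖ ^ 2) * (‖x.2‖ ^ 2 - 1)) x :=
      (hn1.const_sub 1).mul (hn2.sub_const 1)
    have hr2 : DifferentiableAt ℝ (fun x : Space n => √((1 - ‖x.1‖ ^ 2) * (‖x.2‖ ^ 2 - 1))) x :=
      hr1.sqrt (mul_pos hs hu2).ne'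
    have hne : (fun x : Space n => ‖x.2‖ ^ 2) x ≠ 0 := (pow_pos hu0 2).ne'
    have hqd : DifferentiableAt ℝ q x := by
      simp only [hq, div_eq_mul_inv]
      exact hr2.mul (hn2.inv hne)
    have hfd : DifferentiableAt ℝ f x :=
      differentiableAt_fst.prodMk
        ((Complex.ofRealCLM.differentiableAt.comp x hqd).mul differentiableAt_snd)
    have hline : HasDerivAt (fun t : ℝ => x + t • v) v 0 := by
      simpa using ((hasDerivAt_id (0 : ℝ)).smul_const v).const_add x
    have hcomp : HasDerivAt (fun t : ℝ => f (x + t • v)) (fderiv ℝ f x v) 0 := by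
      have h0 : x + (0 : ℝ) • v = x := by simp
      have := hfd.hasFDerivAt
      rw [← h0] at this
      have := this.comp_hasDerivAt (0 : ℝ) hline
      rw [h0] at this
      exact this
    refine hcomp.unique ?_
    have e1 := hns _ x.1 v.1
    have e2 := hns _ x.2 v.2
    have hre : (inner ℂ x.2 v.2).re = u * du x v := by
      rw [← hdu]; simp [mul_comm]
    rw [hre] at e2
    have hN : ∀ (N1 N2 : ℝ → ℝ) (a b : ℝ), HasDerivAt N1 (2 * a) 0 → HasDerivAt N2 (2 * (u * b)) 0 →
        N1 0 = ‖x.1‖ ^ 2 → N2 0 = u ^ 2 →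
        HasDerivAt (fun t => √((1 - N1 t) * (N2 t - 1)) / N2 t)
          (c * (-a / s + b / (u * (u ^ 2 - 1)) - b / u)) 0 := by
      intro N1 N2 a b d1 d2 k1 k2
      have hP : (1 - N1 0) * (N2 0 - 1) = s * (u ^ 2 - 1) := by rw [k1, k2]
      have d3 := (((d1.const_sub 1).mul (d2.sub_const 1)).sqrt
        (by simp only [Pi.mul_apply]; rw [hP]; positivity)).div d2 (by rw [k2]; positivity)
      refine d3.congr_deriv ?_
      simp only [Pi.mul_apply]
      rw [hP, k1, k2, ← hsdef, hc]
      set S := √(s * (u ^ 2 - 1))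
      field_simp
      rw [hsq]
      ring
    have e3 := hN _ _ _ _ e1 e2 (by simp) (by simp [hudef])
    have l1 : HasDerivAt (fun t : ℝ => x.1 + t • v.1) v.1 0 := by
      simpa using ((hasDerivAt_id (0 : ℝ)).smul_const v.1).const_add x.1
    have l2 : HasDerivAt (fun t : ℝ => x.2 + t • v.2) v.2 0 := by
      simpa using ((hasDerivAt_id (0 : ℝ)).smul_const v.2).const_add x.2
    refine (l1.prodMk (e3.ofReal_comp.mul l2)).congr_deriv ?_
    refine Prod.ext rfl ?_
    simp only [zero_smul, add_zero, ← hsdef, ← hudef, ← hc]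
    push_cast
    ring
  have hcn : (1 : ℝ) - ‖polarMap x‖ ^ 2 = s / u ^ 2 := by
    rw [WithLp.prod_norm_sq_eq_of_L2]
    simp only [polarMap, WithLp.toLp_fst, WithLp.toLp_snd, ← hsdef, ← hudef, ← hc, norm_mul, mul_pow,
      Complex.norm_real, Real.norm_eq_abs, sq_abs]
    rw [hc2]
    have : ‖x.1‖ ^ 2 = 1 - s := by rw [hsdef]; ring
    rw [this]
    field_simp
    ring
  have hyy : (starRingEnd ℂ) x.2 * x.2 = ((u ^ 2 : ℝ) : ℂ) := by
    rw [mul_comm, Complex.mul_conj, Complex.normSq_eq_norm_sq]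
  set t : Space n → ℝ := fun v => -(inner ℂ x.1 v.1).re / s + du x v / (u * (u ^ 2 - 1)) with ht
  set φ : Space n → ℝ := fun v => ((starRingEnd ℂ) x.2 * v.2).im / u ^ 2 with hφ
  have hD : ∀ v : Space n, fderiv ℝ (polarMap (n := n)) x v = WithLp.toLp 2
      (v.1, (c : ℂ) * (x.2 * (⟨t v, φ v⟩ : ℂ))) := by
    intro v
    rw [hder v]
    congr 3
    have hA : (starRingEnd ℂ) x.2 * v.2 = ⟨u * du x v, u ^ 2 * φ v⟩ := by
      apply Complex.ext
      · exact hdu v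
      · simp only [hφ]; field_simp
    have hu2c : ((u ^ 2 : ℝ) : ℂ) ≠ 0 := by exact_mod_cast (pow_pos hu0 2).ne'
    have hv : v.2 = x.2 * (⟨du x v / u, φ v⟩ : ℂ) := by
      apply mul_left_cancel₀ hu2c
      have : ((u ^ 2 : ℝ) : ℂ) * v.2 = x.2 * ((starRingEnd ℂ) x.2 * v.2) := by rw [← hyy]; ring
      rw [this, hA]
      have : (⟨u * du x v, u ^ 2 * φ v⟩ : ℂ) = ((u ^ 2 : ℝ) : ℂ) * ⟨du x v / u, φ v⟩ := by
        apply Complex.ext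
        · rw [Complex.re_ofReal_mul]; field_simp
        · rw [Complex.im_ofReal_mul]
      rw [this]; ring
    conv_lhs => rw [hv]
    rw [mul_comm _ x.2, ← mul_add]
    congr 1
    apply Complex.ext
    · rw [Complex.add_re, Complex.ofReal_re]; simp only [ht]; ring
    · rw [Complex.add_im, Complex.ofReal_im, zero_add]
  have hin : ∀ a b : ℂ, inner ℂ ((c : ℂ) * (x.2 * a)) ((c : ℂ) * (x.2 * b))
      = ((c ^ 2 * u ^ 2 : ℝ) : ℂ) * ((starRingEnd ℂ) a * b) := by
    intro a b
    rw [RCLike.inner_apply, Complex.ofReal_mul, ← hyy]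
    simp only [map_mul, Complex.conj_ofReal]
    push_cast
    ring
  have hx1 : polarMap x = WithLp.toLp 2 (x.1, (c : ℂ) * (x.2 * 1)) := by
    rw [mul_one]; rfl
  have hc3 : c ^ 2 * u ^ 2 = s * (u ^ 2 - 1) / u ^ 2 := by rw [hc2]; field_simp
  have hsymm : ∀ v : Space n, inner ℂ v.1 x.1 = (starRingEnd ℂ) (inner ℂ x.1 v.1) := fun v =>
    (inner_conj_symm _ _).symm
  simp only [chMetric, lam, dtheta, hcn]
  simp only [hD, hx1, WithLp.prod_inner_apply, hin, hc3, ← hsdef, ← hudef, hsymm]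
  simp only [Complex.add_re, Complex.mul_re, Complex.mul_im, Complex.conj_re, Complex.conj_im,
    Complex.ofReal_re, Complex.ofReal_im, Complex.add_im, Complex.one_re, Complex.one_im, map_one]
  have hφv : ∀ v : Space n, (x.2.re * v.2.im + -x.2.im * v.2.re) / u ^ 2 = φ v := by
    intro v; simp [hφ]
  simp only [hφv, ht]
  have hu2' : u ^ 2 - 1 ≠ 0 := hu2.ne'
  field_simp
  ring

end CHPolar

end

/-! The metric is diagonalised by a complex coframe. With `eps` = du/(uV) + i dθ and the Hermitian
form `her` of the base, `lam_eq` says λ = u² Re(`her` + V · conj(`eps`) · `eps`). The derivatives of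
`sig` and `her`, together with the exterior derivative of `eps`, are polynomials in `sig`, `her` and
`eps`, so everything that follows is algebra in these forms.

The Levi-Civita connection has the closed form `gam`: `lam_gam` verifies the Koszul formula for it
and positive definiteness gives uniqueness. In the frame it commutes with multiplication by i, so λ
is Kähler for this complex structure. The curvature (`fst_riemann_lam`, `eps_riemann_lam`) is then
polynomial in `her` and `eps`. In the frame, z ↦ R(z,a)b is the sum of a complex linear and a
conjugate-linear map; the latter has real trace zero, and `ricci_lam` gives Ric = -2(A(u) Re `her` +
B(u) Re(conj(`eps`) · `eps`)).

Hence the Einstein equation means A = (n+1)u² and B = (n+1)u²V. The first is the linear equation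
n(1+V) + uV'/2 = (n+1)u²; differentiating it yields the second. Multiplied by 2u^(2n-1), it says
that u^(2n)(V - u² + 1) is locally constant, and the constant on the interval is α (`ode_iff`). -/

noncomputable section

open Complex ComplexConjugate Topology Set

namespace CHPolar

/-! ### Real traces of complex linear and conjugate-linear maps. -/

section Trace

variable {F : Type*} [AddCommGroup F] [Module ℂ F] [Module ℝ F] [IsScalarTower ℝ ℂ F]

/-- The real trace of a complex linear map. -/
theorem trace_restrictScalars_complex [FiniteDimensional ℂ F] [FiniteDimensional ℝ F]
    (L : F →ₗ[ℂ] F) :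
    LinearMap.trace ℝ F (L.restrictScalars ℝ) = 2 * (LinearMap.trace ℂ F L).re := by
  obtain ⟨t, rfl⟩ := (dualTensorHomEquiv ℂ F F).surjective L
  induction t using TensorProduct.induction_on with
  | zero => simp
  | add p q hp hq =>
    have h : ((dualTensorHomEquiv ℂ F F) (p + q)).restrictScalars ℝ
        = ((dualTensorHomEquiv ℂ F F) p).restrictScalars ℝ
          + ((dualTensorHomEquiv ℂ F F) q).restrictScalars ℝ := by
      rw [map_add]; rfl
    rw [h, map_add, hp, hq, map_add, map_add, Complex.add_re, mul_add]
  | tmul φ w =>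
    -- A complex rank-one map is a sum of two real ones, of traces Re φ(w) and Im φ(iw) = Re φ(w).
    have h1 : ((dualTensorHomEquiv ℂ F F) (φ ⊗ₜ[ℂ] w)).restrictScalars ℝ
        = (Complex.reLm ∘ₗ φ.restrictScalars ℝ).smulRight w
          + (Complex.imLm ∘ₗ φ.restrictScalars ℝ).smulRight (Complex.I • w) := by
      ext z
      have : φ z = (((φ z).re : ℝ) : ℂ) + (((φ z).im : ℝ) : ℂ) * I := (Complex.re_add_im _).symm
      simp only [LinearMap.restrictScalars_apply, LinearMap.add_apply, LinearMap.smulRight_apply,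
        dualTensorHomEquiv, LinearEquiv.ofBijective_apply]
      simp only [dualTensorHom_apply, LinearMap.comp_apply,
        LinearMap.restrictScalars_apply, reLm_coe, imLm_coe]
      conv_lhs => rw [this]
      rw [add_smul, mul_smul, ← Complex.coe_algebraMap, algebraMap_smul, algebraMap_smul]
    rw [h1, map_add, LinearMap.trace_smulRight, LinearMap.trace_smulRight]
    have h2 : (LinearMap.trace ℂ F) ((dualTensorHomEquiv ℂ F F) (φ ⊗ₜ[ℂ] w)) = φ w := by
      simp [dualTensorHomEquiv]
    rw [h2]
    simp
    ring

/-- The real trace of a conjugate-linear map vanishes. -/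
theorem trace_eq_zero_of_antilinear (A : F →ₗ[ℝ] F) (hA : ∀ z, A (I • z) = -(I • A z)) :
    LinearMap.trace ℝ F A = 0 := by
  set J : F →ₗ[ℝ] F := (I • (LinearMap.id : F →ₗ[ℂ] F)).restrictScalars ℝ with hJ
  have hJz : ∀ z, J z = I • z := fun z => rfl
  -- With J multiplication by i, JAJ = A but AJJ = -A, while cyclicity makes their traces equal.
  have h1 : J * (A * J) = A := by
    ext z
    simp only [Module.End.mul_apply, hJz, hA, smul_neg, smul_smul, I_mul_I, neg_smul, one_smul,
      neg_neg]
  have h2 : (A * J) * J = -A := by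
    ext z
    simp only [Module.End.mul_apply, hJz, smul_smul, I_mul_I, neg_smul, one_smul, map_neg,
      LinearMap.neg_apply]
  have h3 := LinearMap.trace_mul_comm ℝ J (A * J)
  rw [h1, h2, map_neg] at h3
  linarith

end Trace

/-! ### The complex coframe, and λ expressed in it. -/

variable {n : ℕ}

/-- The complex linear form `⟪ζ, dζ⟫ / (1 - ‖ζ‖²)`. -/
def sig (x v : Space n) : ℂ := inner ℂ x.1 v.1 / (1 - inner ℂ x.1 x.1)

/-- The Hermitian form whose real part is the complex hyperbolic metric on the base. -/
def her (x v w : Space n) : ℂ :=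
  inner ℂ v.1 w.1 / (1 - inner ℂ x.1 x.1) + conj (sig x v) * sig x w

/-- The complex valued form `du / (u V) + i dθ`. -/
def eps (V : ℝ → ℝ) (x v : Space n) : ℂ :=
  (((V ‖x.2‖)⁻¹ * (v.2 / x.2).re : ℝ) : ℂ) + (((v.2 / x.2).im + (sig x v).im : ℝ) : ℂ) * I

theorem one_sub_inner_self (x : Space n) :
    1 - inner ℂ x.1 x.1 = ((1 - ‖x.1‖ ^ 2 : ℝ) : ℂ) := by
  rw [inner_self_eq_norm_sq_to_K]
  simp

theorem conj_one_sub_inner_self (x : Space n) :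
    conj (1 - inner ℂ x.1 x.1 : ℂ) = 1 - inner ℂ x.1 x.1 := by
  rw [map_sub, map_one, inner_conj_symm]

theorem conj_her (x v w : Space n) : conj (her x v w) = her x w v := by
  simp only [her, map_add, map_div₀, map_mul, conj_one_sub_inner_self, inner_conj_symm, conj_conj]
  ring

theorem sig_add (x v w : Space n) : sig x (v + w) = sig x v + sig x w := by
  simp [sig, add_div]

theorem sig_smul (x v : Space n) (c : ℂ) : sig x (c • v) = c * sig x v := by
  simp [sig, mul_div_assoc]

theorem her_add_right (x v w z : Space n) : her x v (w + z) = her x v w + her x v z := by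
  simp only [her, sig_add, Prod.fst_add, inner_add_right]; ring

theorem her_smul_right (x v w : Space n) (c : ℂ) : her x v (c • w) = c * her x v w := by
  simp only [her, sig_smul, Prod.smul_fst, inner_smul_right]; ring

theorem her_congr {x v v' w w' : Space n} (hv : v.1 = v'.1) (hw : w.1 = w'.1) :
    her x v w = her x v' w' := by
  simp only [her, sig, hv, hw]

theorem sig_congr {x v v' : Space n} (hv : v.1 = v'.1) : sig x v = sig x v' := by
  simp only [sig, hv]

theorem her_self_nonneg (x v : Space n) (hx : ‖x.1‖ < 1) : 0 ≤ (her x v v).re := by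
  have hs : 0 < 1 - ‖x.1‖ ^ 2 := by nlinarith [norm_nonneg x.1]
  rw [her, one_sub_inner_self, inner_self_eq_norm_sq_to_K, ← Complex.normSq_eq_conj_mul_self]
  have : ((‖v.1‖ : ℂ) ^ 2 / ((1 - ‖x.1‖ ^ 2 : ℝ) : ℂ) + ((normSq (sig x v) : ℝ) : ℂ)).re
      = ‖v.1‖ ^ 2 / (1 - ‖x.1‖ ^ 2) + normSq (sig x v) := by
    rw [← Complex.ofReal_pow, ← Complex.ofReal_div, ← Complex.ofReal_add, Complex.ofReal_re]
  refine this.symm ▸ ?_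
  have := normSq_nonneg (sig x v)
  positivity

theorem fst_eq_zero_of_her_self {x v : Space n} (hx : ‖x.1‖ < 1) (h : (her x v v).re = 0) :
    v.1 = 0 := by
  have hs : 0 < 1 - ‖x.1‖ ^ 2 := by nlinarith [norm_nonneg x.1]
  rw [her, one_sub_inner_self, inner_self_eq_norm_sq_to_K, ← Complex.normSq_eq_conj_mul_self] at h
  have : ((‖v.1‖ : ℂ) ^ 2 / ((1 - ‖x.1‖ ^ 2 : ℝ) : ℂ) + ((normSq (sig x v) : ℝ) : ℂ)).re
      = ‖v.1‖ ^ 2 / (1 - ‖x.1‖ ^ 2) + normSq (sig x v) := by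
    rw [← Complex.ofReal_pow, ← Complex.ofReal_div, ← Complex.ofReal_add, Complex.ofReal_re]
  have h := this.symm.trans h
  have h1 := normSq_nonneg (sig x v)
  have h2 : 0 ≤ ‖v.1‖ ^ 2 / (1 - ‖x.1‖ ^ 2) := by positivity
  have h3 : ‖v.1‖ ^ 2 / (1 - ‖x.1‖ ^ 2) = 0 := by linarith
  rw [div_eq_zero_iff] at h3
  rcases h3 with h3 | h3
  · simpa using h3
  · exact absurd h3 hs.ne'

/-- Dividing by y gives d log y = du/u + i d(arg y), and the imaginary part of `sig` completes d(arg
y) to dθ. The factor V⁻¹ in the real part of `eps` turns V · V⁻² into the 1/V of the du² term. -/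
theorem lam_eq {V : ℝ → ℝ} {x : Space n} (hy : x.2 ≠ 0) (hV : V ‖x.2‖ ≠ 0) (v w : Space n) :
    lam V x v w = ‖x.2‖ ^ 2 *
      (her x v w + ((V ‖x.2‖ : ℝ) : ℂ) * (conj (eps V x v) * eps V x w)).re := by
  have hu : ‖x.2‖ ≠ 0 := norm_ne_zero_iff.2 hy
  have hdiv : ∀ v : Space n, v.2 / x.2 = conj x.2 * v.2 * ((‖x.2‖ ^ 2)⁻¹ : ℝ) := by
    intro v
    rw [div_eq_mul_inv, Complex.inv_def, Complex.normSq_eq_norm_sq]; ring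
  have hre : ∀ v : Space n, (v.2 / x.2).re = du x v / ‖x.2‖ := by
    intro v; rw [hdiv, Complex.re_mul_ofReal, du]; field_simp
  have him : ∀ v : Space n, (v.2 / x.2).im = ((starRingEnd ℂ) x.2 * v.2).im / ‖x.2‖ ^ 2 := by
    intro v; rw [hdiv, Complex.im_mul_ofReal]; field_simp
  have hsig : ∀ v : Space n, (sig x v).im = (inner ℂ x.1 v.1).im / (1 - ‖x.1‖ ^ 2) := by
    intro v; rw [sig, one_sub_inner_self, Complex.div_ofReal_im]
  have heps : ∀ v, eps V x v = (((V ‖x.2‖)⁻¹ * (du x v / ‖x.2‖) : ℝ) : ℂ) + (dtheta x v : ℝ) * I := by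
    intro v; rw [eps, hre, him, hsig, dtheta]
  have hc : chMetric x.1 v.1 w.1 = (her x v w).re := by
    rw [her, chMetric, Complex.add_re, sig, sig, map_div₀, conj_one_sub_inner_self, inner_conj_symm,
      one_sub_inner_self, Complex.div_ofReal_re, div_mul_div_comm, ← Complex.ofReal_mul,
      Complex.div_ofReal_re, sq (1 - ‖x.1‖ ^ 2)]
  rw [lam, hc, heps, heps]
  simp
  field_simp
  ring

theorem one_sub_inner_self_ne_zero {x : Space n} (hx : ‖x.1‖ < 1) : (1 - inner ℂ x.1 x.1 : ℂ) ≠ 0 := by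
  have hs : 0 < 1 - ‖x.1‖ ^ 2 := by nlinarith [norm_nonneg x.1]
  rw [one_sub_inner_self]
  exact_mod_cast hs.ne'

/-! ### Smoothness and first derivatives of the coframe. -/

theorem contDiff_inner_const (v : Space n) : ContDiff ℝ ⊤ (fun y : Space n => inner ℂ y.1 v.1) :=
  contDiff_fst.inner ℂ contDiff_const

theorem contDiff_inner_self : ContDiff ℝ ⊤ (fun y : Space n => (1 - inner ℂ y.1 y.1 : ℂ)) :=
  contDiff_const.sub (contDiff_fst.inner ℂ contDiff_fst)

theorem contDiffAt_sig {x : Space n} (hx : ‖x.1‖ < 1) (v : Space n) :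
    ContDiffAt ℝ ⊤ (fun y => sig y v) x := by
  simp only [sig, div_eq_mul_inv]
  exact (contDiff_inner_const v).contDiffAt.mul (contDiff_inner_self.contDiffAt.inv
    (one_sub_inner_self_ne_zero hx))

theorem contDiffAt_her {x : Space n} (hx : ‖x.1‖ < 1) (v w : Space n) :
    ContDiffAt ℝ ⊤ (fun y => her y v w) x := by
  simp only [her, div_eq_mul_inv]
  refine (contDiffAt_const.mul (contDiff_inner_self.contDiffAt.inv
    (one_sub_inner_self_ne_zero hx))).add (ContDiffAt.mul ?_ (contDiffAt_sig hx w))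
  exact (Complex.conjCLE.contDiff.contDiffAt).comp x (contDiffAt_sig hx v)

theorem hasFDerivAt_inner_const (x v : Space n) : ∃ L : Space n →L[ℝ] ℂ,
    HasFDerivAt (fun y : Space n => inner ℂ y.1 v.1) L x ∧ ∀ z, L z = inner ℂ z.1 v.1 := by
  refine ⟨_, ((contDiff_inner_const v).differentiable (by simp) x).hasFDerivAt, fun z => ?_⟩
  have := fderiv_inner_apply ℂ (f := fun y : Space n => y.1) (g := fun _ : Space n => v.1) (x := x)
    differentiableAt_fst (differentiableAt_const _) z
  rw [this]
  simp [fderiv_fst]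

theorem hasFDerivAt_inner_self (x : Space n) : ∃ L : Space n →L[ℝ] ℂ,
    HasFDerivAt (fun y : Space n => (1 - inner ℂ y.1 y.1 : ℂ)) L x ∧
      ∀ z, L z = -(inner ℂ x.1 z.1 + inner ℂ z.1 x.1) := by
  have h : DifferentiableAt ℝ (fun y : Space n => (inner ℂ y.1 y.1 : ℂ)) x :=
    differentiableAt_fst.inner ℂ differentiableAt_fst
  refine ⟨_, h.hasFDerivAt.const_sub 1, fun z => ?_⟩
  have := fderiv_inner_apply ℂ (f := fun y : Space n => y.1) (g := fun y : Space n => y.1) (x := x)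
    differentiableAt_fst differentiableAt_fst z
  rw [neg_apply, this]
  simp [fderiv_fst]

theorem hasFDerivAt_inv_one_sub_inner_self {x : Space n} (hx : ‖x.1‖ < 1) :
    ∃ L : Space n →L[ℝ] ℂ, HasFDerivAt (fun y : Space n => (1 - inner ℂ y.1 y.1 : ℂ)⁻¹) L x ∧
      ∀ z, L z = (inner ℂ x.1 z.1 + inner ℂ z.1 x.1) / (1 - inner ℂ x.1 x.1) ^ 2 := by
  obtain ⟨M, hM, hMz⟩ := hasFDerivAt_inner_self x
  have h := (hasDerivAt_inv (one_sub_inner_self_ne_zero hx)).complexToReal_fderiv.comp x hM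
  refine ⟨_, h, fun z => ?_⟩
  rw [ContinuousLinearMap.comp_apply, hMz]
  simp
  field_simp
  ring

/-- `sig` is -∂ log(1 - ‖ζ‖²). Its derivative therefore has the Kähler form of the base as mixed
part, plus a symmetric complex bilinear part. -/
theorem fderiv_sig {x : Space n} (hx : ‖x.1‖ < 1) (v z : Space n) :
    fderiv ℝ (fun y => sig y v) x z = her x z v + sig x v * sig x z := by
  obtain ⟨L, hL, hLz⟩ := hasFDerivAt_inner_const x v
  obtain ⟨M, hM, hMz⟩ := hasFDerivAt_inv_one_sub_inner_self hx
  have hs := one_sub_inner_self_ne_zero hx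
  have h : HasFDerivAt (fun y => sig y v) _ x := hL.mul hM
  rw [h.fderiv]
  simp only [her, sig, map_div₀, conj_one_sub_inner_self, inner_conj_symm]
  simp [hLz, hMz]
  field_simp
  ring

theorem fderiv_her {x : Space n} (hx : ‖x.1‖ < 1) (v w z : Space n) :
    fderiv ℝ (fun y => her y v w) x z = her x v w * (sig x z + conj (sig x z))
      + her x v z * sig x w + conj (sig x v) * her x z w := by
  obtain ⟨M, hM, hMz⟩ := hasFDerivAt_inv_one_sub_inner_self hx
  have hs := one_sub_inner_self_ne_zero hx
  have hv := ((contDiffAt_sig hx v).differentiableAt (by simp)).hasFDerivAt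
  have hw := ((contDiffAt_sig hx w).differentiableAt (by simp)).hasFDerivAt
  have h1 := (hasFDerivAt_const (inner ℂ v.1 w.1 : ℂ) x).mul hM
  have h2 : HasFDerivAt (fun y => conj (sig y v)) _ x := Complex.conjCLE.hasFDerivAt.comp x hv
  have h := h1.add (h2.mul hw)
  have e : (fun y => her y v w) = fun y : Space n => inner ℂ v.1 w.1 / (1 - inner ℂ y.1 y.1)
    + conj (sig y v) * sig y w := rfl
  have h' : HasFDerivAt (fun y => her y v w) _ x := h
  rw [h'.fderiv]
  simp only [add_apply, smul_apply,
    ContinuousLinearMap.comp_apply, fderiv_sig hx, hMz,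
    zero_apply, smul_eq_mul, ContinuousLinearEquiv.coe_coe, conjCLE_apply,
    map_add, map_mul, conj_her]
  simp only [her, sig, map_div₀, conj_one_sub_inner_self, inner_conj_symm]
  field_simp
  ring

theorem hasFDerivAt_norm_snd {x : Space n} (hy : x.2 ≠ 0) : ∃ L : Space n →L[ℝ] ℝ,
    HasFDerivAt (fun y : Space n => ‖y.2‖) L x ∧ ∀ z, L z = ‖x.2‖ * (z.2 / x.2).re := by
  have hu : ‖x.2‖ ≠ 0 := norm_ne_zero_iff.2 hy
  have hd : DifferentiableAt ℝ (fun y : Space n => ‖y.2‖) x := differentiableAt_snd.norm ℂ hy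
  refine ⟨_, hd.hasFDerivAt, fun z => ?_⟩
  have h2 := (hd.hasFDerivAt.pow 2).fderiv
  have h3 := fderiv_inner_apply ℂ (f := fun y : Space n => y.2) (g := fun y : Space n => y.2) (x := x)
    differentiableAt_snd differentiableAt_snd z
  have h4 : DifferentiableAt ℝ (fun y : Space n => (inner ℂ y.2 y.2 : ℂ)) x :=
    differentiableAt_snd.inner ℂ differentiableAt_snd
  have h5 : HasFDerivAt (fun y : Space n => ‖y.2‖ ^ 2) _ x :=
    (Complex.reCLM.hasFDerivAt.comp x h4.hasFDerivAt).congr_of_eventuallyEq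
      (Filter.Eventually.of_forall fun y => by
        simp only [Function.comp_apply, inner_self_eq_norm_sq_to_K]; norm_cast)
  -- The derivative of the norm is read off by differentiating its square in two ways.
  have h6 := congrArg (fun T => T z) (h5.unique (hd.hasFDerivAt.pow 2))
  simp only [ContinuousLinearMap.comp_apply, h3] at h6
  simp [fderiv_snd] at h6
  have hdiv : (z.2 / x.2).re = (x.2.re * z.2.re + x.2.im * z.2.im) / ‖x.2‖ ^ 2 := by
    rw [Complex.div_re, Complex.normSq_eq_norm_sq]; ring
  rw [hdiv]
  field_simp
  linarith

theorem fderiv_comp_norm_snd {x : Space n} (hy : x.2 ≠ 0) {φ : ℝ → ℝ}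
    (hφ : DifferentiableAt ℝ φ ‖x.2‖) (z : Space n) :
    fderiv ℝ (fun y : Space n => φ ‖y.2‖) x z = deriv φ ‖x.2‖ * ‖x.2‖ * (z.2 / x.2).re := by
  obtain ⟨L, hL, hLz⟩ := hasFDerivAt_norm_snd hy
  have h := hφ.hasDerivAt.comp_hasFDerivAt x hL
  have h' : HasFDerivAt (fun y : Space n => φ ‖y.2‖) _ x := h
  rw [h'.fderiv]
  simp [hLz]
  ring

/-! ### The profile V, and the structure equation of `eps`. -/

/-- `V` is a smooth positive function on the open set `I` of positive numbers. -/
structure IsProfile (V : ℝ → ℝ) (I : Set ℝ) : Prop where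
  isOpen : IsOpen I
  pos : I ⊆ Ioi 0
  smooth : ContDiffOn ℝ (⊤ : ℕ∞) V I
  pos_map : ∀ u ∈ I, 0 < V u

theorem isOpen_polarDomain {I : Set ℝ} (hI : IsOpen I) : IsOpen (polarDomain n I) := by
  have h1 : IsOpen {x : Space n | ‖x.1‖ < 1} := isOpen_lt (by fun_prop) continuous_const
  have h2 : IsOpen {x : Space n | ‖x.2‖ ∈ I} :=
    hI.preimage (f := fun x : Space n => ‖x.2‖) (by fun_prop)
  exact h1.inter h2

variable {V : ℝ → ℝ} {U : Set ℝ} {x : Space n}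

theorem IsProfile.snd_ne_zero (hV : IsProfile V U) (hx : x ∈ polarDomain n U) : x.2 ≠ 0 :=
  norm_pos_iff.1 (hV.pos hx.2)

theorem IsProfile.ne_zero (hV : IsProfile V U) (hx : x ∈ polarDomain n U) : V ‖x.2‖ ≠ 0 :=
  (hV.pos_map _ hx.2).ne'

theorem IsProfile.contDiffAt (hV : IsProfile V U) {u : ℝ} (hu : u ∈ U) :
    ContDiffAt ℝ (⊤ : ℕ∞) V u :=
  hV.smooth.contDiffAt (hV.isOpen.mem_nhds hu)

theorem IsProfile.differentiableAt (hV : IsProfile V U) {u : ℝ} (hu : u ∈ U) :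
    DifferentiableAt ℝ V u :=
  (hV.contDiffAt hu).differentiableAt (by simp)

theorem IsProfile.differentiableAt_deriv (hV : IsProfile V U) {u : ℝ} (hu : u ∈ U) :
    DifferentiableAt ℝ (deriv V) u :=
  (((hV.smooth.deriv_of_isOpen (m := 1) hV.isOpen (by norm_cast)).contDiffAt
    (hV.isOpen.mem_nhds hu))).differentiableAt (by simp)

theorem IsProfile.mem_nhds (hV : IsProfile V U) (hx : x ∈ polarDomain n U) :
    polarDomain n U ∈ 𝓝 x :=
  (isOpen_polarDomain hV.isOpen).mem_nhds hx

theorem contDiffAt_norm_snd (hy : x.2 ≠ 0) :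
    ContDiffAt ℝ (⊤ : ℕ∞) (fun y : Space n => ‖y.2‖) x :=
  contDiffAt_snd.norm ℂ hy

theorem contDiffAt_div_snd (hy : x.2 ≠ 0) (c : ℂ) :
    ContDiffAt ℝ (⊤ : ℕ∞) (fun y : Space n => c / y.2) x := by
  simp only [div_eq_mul_inv]
  exact contDiffAt_const.mul (contDiffAt_snd.inv hy)

theorem fderiv_div_snd (hy : x.2 ≠ 0) (v z : Space n) :
    fderiv ℝ (fun y : Space n => v.2 / y.2) x z = -((v.2 / x.2) * (z.2 / x.2)) := by
  have h := (hasDerivAt_inv hy).complexToReal_fderiv.comp x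
    (hasFDerivAt_snd (𝕜 := ℝ) (E := EuclideanSpace ℂ (Fin (n - 1))) (F := ℂ) (p := x))
  have h' : HasFDerivAt (fun y : Space n => v.2 / y.2) _ x :=
    (h.const_mul v.2).congr_of_eventuallyEq
      (Filter.Eventually.of_forall fun y => div_eq_mul_inv _ _)
  rw [h'.fderiv]
  simp
  field_simp

theorem contDiffAt_eps (hV : IsProfile V U) (hx : x ∈ polarDomain n U) (v : Space n) :
    ContDiffAt ℝ (⊤ : ℕ∞) (fun y => eps V y v) x := by
  have hy := hV.snd_ne_zero hx
  have h1 := contDiffAt_div_snd hy v.2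
  have h2 : ContDiffAt ℝ (⊤ : ℕ∞) (fun y => sig y v) x := (contDiffAt_sig hx.1 v).of_le le_top
  have h3 : ContDiffAt ℝ (⊤ : ℕ∞) (fun y : Space n => V ‖y.2‖) x :=
    (hV.contDiffAt hx.2).comp x (contDiffAt_norm_snd hy)
  have hre : ContDiffAt ℝ (⊤ : ℕ∞) (fun y : Space n => (v.2 / y.2).re) x :=
    Complex.reCLM.contDiff.contDiffAt.comp x h1
  have him : ContDiffAt ℝ (⊤ : ℕ∞) (fun y : Space n => (v.2 / y.2).im) x :=
    Complex.imCLM.contDiff.contDiffAt.comp x h1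
  have him' : ContDiffAt ℝ (⊤ : ℕ∞) (fun y : Space n => (sig y v).im) x :=
    Complex.imCLM.contDiff.contDiffAt.comp x h2
  have h4 := Complex.ofRealCLM.contDiff.contDiffAt.comp x ((h3.inv (hV.ne_zero hx)).mul hre)
  have h5 := Complex.ofRealCLM.contDiff.contDiffAt.comp x (him.add him')
  exact h4.add (h5.mul contDiffAt_const)

theorem fderiv_re {f : Space n → ℂ} (hf : DifferentiableAt ℝ f x) (z : Space n) :
    fderiv ℝ (fun y => (f y).re) x z = (fderiv ℝ f x z).re := by
  have h : HasFDerivAt (fun y => (f y).re) _ x := Complex.reCLM.hasFDerivAt.comp x hf.hasFDerivAt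
  rw [h.fderiv]; rfl

theorem fderiv_im {f : Space n → ℂ} (hf : DifferentiableAt ℝ f x) (z : Space n) :
    fderiv ℝ (fun y => (f y).im) x z = (fderiv ℝ f x z).im := by
  have h : HasFDerivAt (fun y => (f y).im) _ x := Complex.imCLM.hasFDerivAt.comp x hf.hasFDerivAt
  rw [h.fderiv]; rfl

theorem eps_re (x v : Space n) : (eps V x v).re = (V ‖x.2‖)⁻¹ * (v.2 / x.2).re := by
  simp [eps]

theorem eps_im (x v : Space n) : (eps V x v).im = (v.2 / x.2).im + (sig x v).im := by
  simp [eps]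

/-- The exterior derivative of `eps`. -/
theorem fderiv_eps_sub (hV : IsProfile V U) (hx : x ∈ polarDomain n U) (v z : Space n) :
    fderiv ℝ (fun y => eps V y v) x z - fderiv ℝ (fun y => eps V y z) x v
      = her x z v - her x v z := by
  have hy := hV.snd_ne_zero hx
  have hd : ∀ v : Space n, DifferentiableAt ℝ (fun y => eps V y v) x := fun v =>
    (contDiffAt_eps hV hx v).differentiableAt (by simp)
  have hρ : ∀ v : Space n, DifferentiableAt ℝ (fun y : Space n => v.2 / y.2) x := fun v =>
    (contDiffAt_div_snd hy v.2).differentiableAt (by simp)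
  have hσ : ∀ v : Space n, DifferentiableAt ℝ (fun y => sig y v) x := fun v =>
    (contDiffAt_sig hx.1 v).differentiableAt (by simp)
  have hW : DifferentiableAt ℝ (fun u => (V u)⁻¹) ‖x.2‖ :=
    (hV.differentiableAt hx.2).inv (hV.ne_zero hx)
  have hWn : DifferentiableAt ℝ (fun y : Space n => (V ‖y.2‖)⁻¹) x :=
    hW.comp x (f := fun y : Space n => ‖y.2‖) ((contDiffAt_norm_snd hy).differentiableAt (by simp))
  have hre : ∀ v z : Space n, (fderiv ℝ (fun y => eps V y v) x z).re
      = (V ‖x.2‖)⁻¹ * (-((v.2 / x.2) * (z.2 / x.2))).re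
        + (v.2 / x.2).re * (deriv (fun u => (V u)⁻¹) ‖x.2‖ * ‖x.2‖ * (z.2 / x.2).re) := by
    intro v z
    have hre' : DifferentiableAt ℝ (fun y : Space n => (v.2 / y.2).re) x :=
      Complex.reCLM.differentiableAt.comp x (hρ v)
    rw [← fderiv_re (hd v)]
    simp only [eps_re]
    have h := fderiv_comp_norm_snd hy hW z
    rw [fderiv_fun_mul hWn hre', add_apply, smul_apply, smul_apply, fderiv_re (hρ v),
      fderiv_div_snd hy, h, smul_eq_mul, smul_eq_mul]
  have him : ∀ v z : Space n, (fderiv ℝ (fun y => eps V y v) x z).im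
      = (-((v.2 / x.2) * (z.2 / x.2))).im + (her x z v + sig x v * sig x z).im := by
    intro v z
    rw [← fderiv_im (hd v)]
    simp only [eps_im]
    have h1 : DifferentiableAt ℝ (fun y : Space n => (v.2 / y.2).im) x :=
      Complex.imCLM.differentiableAt.comp x (hρ v)
    have h2 : DifferentiableAt ℝ (fun y : Space n => (sig y v).im) x :=
      Complex.imCLM.differentiableAt.comp x (hσ v)
    rw [fderiv_fun_add h1 h2, add_apply, fderiv_im (hρ v),
      fderiv_im (hσ v), fderiv_div_snd hy, fderiv_sig hx.1]
  -- What is symmetric in v and z cancels: the product of the two logarithmic differentials, the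
  -- term with the derivative of 1/V, and `sig` times `sig`. Only the imaginary part of `her`
  -- survives.
  apply Complex.ext
  · rw [Complex.sub_re, hre, hre, Complex.sub_re, ← conj_her x v z, Complex.conj_re]
    simp only [Complex.neg_re, Complex.mul_re]
    ring
  · rw [Complex.sub_im, him, him, Complex.sub_im]
    simp only [Complex.neg_im, Complex.mul_im, Complex.add_im]
    ring

theorem eps_add (x v w : Space n) : eps V x (v + w) = eps V x v + eps V x w := by
  apply Complex.ext
  · simp only [eps_re, Complex.add_re, Prod.snd_add, add_div]; ring
  · simp only [eps_im, Complex.add_im, Prod.snd_add, add_div, sig_add]; ring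

theorem eps_smul (x v : Space n) (r : ℝ) : eps V x (r • v) = r • eps V x v := by
  have h : r • v = (r : ℂ) • v := (Complex.coe_smul r v).symm
  apply Complex.ext
  · simp only [eps_re, Complex.smul_re, h, Prod.smul_snd, smul_eq_mul, mul_div_assoc,
      Complex.re_ofReal_mul]; ring
  · simp only [eps_im, Complex.smul_im, h, Prod.smul_snd, smul_eq_mul, mul_div_assoc,
      Complex.im_ofReal_mul, sig_smul]; ring

/-- The tangent vector with base component `c` and `eps`-component `e`. -/
def ofFrame (V : ℝ → ℝ) (x : Space n) (c : EuclideanSpace ℂ (Fin (n - 1))) (e : ℂ) : Space n :=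
  (c, x.2 * (((V ‖x.2‖ * e.re : ℝ) : ℂ) + ((e.im - (sig x (c, 0)).im : ℝ) : ℂ) * I))

theorem eps_ofFrame (hV : IsProfile V U) (hx : x ∈ polarDomain n U)
    (c : EuclideanSpace ℂ (Fin (n - 1))) (e : ℂ) : eps V x (ofFrame V x c e) = e := by
  have hy := hV.snd_ne_zero hx
  have hne := hV.ne_zero hx
  have hs : sig x (ofFrame V x c e) = sig x (c, 0) := sig_congr rfl
  have h2 : (ofFrame V x c e).2 / x.2
      = ((V ‖x.2‖ * e.re : ℝ) : ℂ) + ((e.im - (sig x (c, 0)).im : ℝ) : ℂ) * I := by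
    rw [ofFrame]; field_simp
  apply Complex.ext
  · rw [eps_re, h2]; simp [hne]
  · rw [eps_im, h2, hs]; simp

theorem ext_frame (hV : IsProfile V U) (hx : x ∈ polarDomain n U) {v w : Space n}
    (h1 : v.1 = w.1) (h2 : eps V x v = eps V x w) : v = w := by
  have hy := hV.snd_ne_zero hx
  have hne := hV.ne_zero hx
  have hre := congrArg Complex.re h2
  have him := congrArg Complex.im h2
  rw [eps_re, eps_re] at hre
  rw [eps_im, eps_im, sig_congr h1] at him
  have h3 : v.2 / x.2 = w.2 / x.2 := by
    apply Complex.ext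
    · exact mul_left_cancel₀ (inv_ne_zero hne) hre
    · linarith
  refine Prod.ext h1 ?_
  rwa [div_left_inj' hy] at h3

/-! ### The Levi-Civita connection. -/

/-- `V + u V' / 2`. -/
def fibreCoeff (V : ℝ → ℝ) (u : ℝ) : ℝ := V u + u * deriv V u / 2

/-- The connection form of the base components of the Levi-Civita connection of `lam V`. -/
def tau (V : ℝ → ℝ) (x v : Space n) : ℂ := sig x v + ((V ‖x.2‖ : ℝ) : ℂ) * eps V x v

/-- The covariant derivative of the form `eps`. -/
def covEps (V : ℝ → ℝ) (x v w : Space n) : ℂ :=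
  her x v w - ((fibreCoeff V ‖x.2‖ : ℝ) : ℂ) * (eps V x v * eps V x w)

/-- The Christoffel symbols of `lam V` in closed form. -/
def gam (V : ℝ → ℝ) (x v w : Space n) : Space n :=
  ofFrame V x (tau V x v • w.1 + tau V x w • v.1)
    (fderiv ℝ (fun y => eps V y w) x v - covEps V x v w)

theorem gam_fst (x v w : Space n) : (gam V x v w).1 = tau V x v • w.1 + tau V x w • v.1 := rfl

theorem eps_gam (hV : IsProfile V U) (hx : x ∈ polarDomain n U) (v w : Space n) :
    eps V x (gam V x v w) = fderiv ℝ (fun y => eps V y w) x v - covEps V x v w :=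
  eps_ofFrame hV hx _ _

theorem her_gam_right (x v w z : Space n) :
    her x z (gam V x v w) = tau V x v * her x z w + tau V x w * her x z v := by
  rw [← her_smul_right, ← her_smul_right, ← her_add_right]
  exact her_congr rfl rfl

theorem sig_gam (x v w : Space n) :
    sig x (gam V x v w) = tau V x v * sig x w + tau V x w * sig x v := by
  rw [← sig_smul, ← sig_smul, ← sig_add]
  exact sig_congr rfl

theorem her_gam_left (x v w z : Space n) : her x (gam V x v w) z
    = conj (tau V x v) * her x w z + conj (tau V x w) * her x v z := by
  rw [← conj_her, her_gam_right, map_add, map_mul, map_mul, conj_her, conj_her]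

/-- The derivatives of `eps` stay unevaluated: the Koszul formula needs only their antisymmetric
parts, supplied by `fderiv_eps_sub`. -/
theorem fderiv_lam (hV : IsProfile V U) (hx : x ∈ polarDomain n U) (v w z : Space n) :
    fderiv ℝ (fun y => lam V y v w) x z = ‖x.2‖ ^ 2 * (
      2 * (V ‖x.2‖ * (eps V x z).re) *
        (her x v w + ((V ‖x.2‖ : ℝ) : ℂ) * (conj (eps V x v) * eps V x w)).re
      + (her x v w * (sig x z + conj (sig x z)) + her x v z * sig x w + conj (sig x v) * her x z w
        + ((deriv V ‖x.2‖ * ‖x.2‖ * (V ‖x.2‖ * (eps V x z).re) : ℝ) : ℂ)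
            * (conj (eps V x v) * eps V x w)
        + ((V ‖x.2‖ : ℝ) : ℂ) * (conj (fderiv ℝ (fun y => eps V y v) x z) * eps V x w
          + conj (eps V x v) * fderiv ℝ (fun y => eps V y w) x z)).re) := by
  have hy := hV.snd_ne_zero hx
  have hne := hV.ne_zero hx
  have hp : (z.2 / x.2).re = V ‖x.2‖ * (eps V x z).re := by
    rw [eps_re]; field_simp
  have e : (fun y => lam V y v w) =ᶠ[𝓝 x] fun y : Space n => ‖y.2‖ ^ 2 *
      (her y v w + ((V ‖y.2‖ : ℝ) : ℂ) * (conj (eps V y v) * eps V y w)).re := by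
    filter_upwards [hV.mem_nhds hx] with y hy
    exact lam_eq (hV.snd_ne_zero hy) (hV.ne_zero hy) v w
  rw [e.fderiv_eq]
  have hd : ∀ v : Space n, DifferentiableAt ℝ (fun y => eps V y v) x := fun v =>
    (contDiffAt_eps hV hx v).differentiableAt (by simp)
  have hh : DifferentiableAt ℝ (fun y => her y v w) x :=
    (contDiffAt_her hx.1 v w).differentiableAt (by simp)
  have hn : DifferentiableAt ℝ (fun y : Space n => ‖y.2‖) x :=
    (contDiffAt_norm_snd hy).differentiableAt (by simp)
  have hVn : DifferentiableAt ℝ (fun y : Space n => V ‖y.2‖) x :=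
    (hV.differentiableAt hx.2).comp x hn
  have hVc : HasFDerivAt (fun y : Space n => ((V ‖y.2‖ : ℝ) : ℂ)) _ x :=
    Complex.ofRealCLM.hasFDerivAt.comp x hVn.hasFDerivAt
  have hcj : HasFDerivAt (fun y => conj (eps V y v)) _ x :=
    Complex.conjCLE.hasFDerivAt.comp x (hd v).hasFDerivAt
  have h1 := hh.hasFDerivAt.add (hVc.mul (hcj.mul (hd w).hasFDerivAt))
  have h2 : HasFDerivAt (fun y => (her y v w + ((V ‖y.2‖ : ℝ) : ℂ)
    * (conj (eps V y v) * eps V y w)).re) _ x := Complex.reCLM.hasFDerivAt.comp x h1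
  have hsq : DifferentiableAt ℝ (fun u : ℝ => u ^ 2) ‖x.2‖ := differentiableAt_pow 2
  have h3 := fderiv_comp_norm_snd hy hsq z
  have h4 := fderiv_comp_norm_snd hy (hV.differentiableAt hx.2) z
  rw [fderiv_fun_mul (hn.fun_pow 2) h2.differentiableAt, add_apply, smul_apply, smul_apply, h3,
    h2.fderiv]
  simp only [ContinuousLinearMap.comp_apply, add_apply, smul_apply, fderiv_her hx.1, h4,
    ContinuousLinearEquiv.coe_coe, conjCLE_apply, ofRealCLM_apply, reCLM_apply, smul_eq_mul, hp]
  simp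
  ring

theorem lam_gam (hV : IsProfile V U) (hx : x ∈ polarDomain n U) (v w z : Space n) :
    lam V x (gam V x v w) z = koszul (lam V) x v w z := by
  have hne := hV.ne_zero hx
  have k1 := fderiv_eps_sub hV hx v z
  have k2 := fderiv_eps_sub hV hx w z
  have k3 := fderiv_eps_sub hV hx w v
  rw [koszul, fderiv_lam hV hx, fderiv_lam hV hx, fderiv_lam hV hx,
    lam_eq (hV.snd_ne_zero hx) hne, her_gam_left, eps_gam hV hx]
  simp only [covEps, tau, fibreCoeff]
  simp only [← conj_her x v w, ← conj_her x v z, ← conj_her x w z] at k1 k2 k3 ⊢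
  generalize her x v w = a at *
  generalize her x v z = b at *
  generalize her x w z = c at *
  generalize eps V x v = p at *
  generalize eps V x w = q at *
  generalize eps V x z = r at *
  generalize sig x v = sv at *
  generalize sig x w = sw at *
  generalize sig x z = sz at *
  generalize hvz : fderiv ℝ (fun y => eps V y v) x z = dvz at *
  generalize hzv : fderiv ℝ (fun y => eps V y z) x v = dzv at *
  generalize fderiv ℝ (fun y => eps V y w) x z = dwz at *
  generalize fderiv ℝ (fun y => eps V y z) x w = dzw at *
  generalize fderiv ℝ (fun y => eps V y w) x v = dwv at *
  generalize fderiv ℝ (fun y => eps V y v) x w = dvw at *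
  -- The structure equation eliminates one of each pair of derivatives of `eps`; what remains is a
  -- polynomial identity in real and imaginary parts.
  obtain rfl : dvz = dzv + (conj b - b) := by rw [← k1]; ring
  obtain rfl : dwz = dzw + (conj c - c) := by rw [← k2]; ring
  obtain rfl : dwv = dvw + (a - conj a) := by rw [← k3]; ring
  simp only [Complex.sub_re, Complex.sub_im, Complex.conj_re, Complex.conj_im, Complex.add_re,
    Complex.add_im, Complex.mul_re, Complex.mul_im, Complex.ofReal_re, Complex.ofReal_im]
  ring

theorem her_add_left (x v w z : Space n) : her x (v + w) z = her x v z + her x w z := by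
  rw [← conj_her, her_add_right, map_add, conj_her, conj_her]

theorem lam_add_left (hV : IsProfile V U) (hx : x ∈ polarDomain n U) (v w z : Space n) :
    lam V x (v + w) z = lam V x v z + lam V x w z := by
  have hy := hV.snd_ne_zero hx
  have hne := hV.ne_zero hx
  rw [lam_eq hy hne, lam_eq hy hne, lam_eq hy hne, her_add_left, eps_add, map_add, ← mul_add,
    ← Complex.add_re]
  congr 2
  ring

theorem eq_zero_of_lam_self (hV : IsProfile V U) (hx : x ∈ polarDomain n U) {v : Space n}
    (h : lam V x v v = 0) : v = 0 := by
  have hy := hV.snd_ne_zero hx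
  have hne := hV.ne_zero hx
  have hpos := hV.pos_map _ hx.2
  have hu : ‖x.2‖ ^ 2 ≠ 0 := pow_ne_zero 2 (norm_ne_zero_iff.2 hy)
  rw [lam_eq hy hne, ← Complex.normSq_eq_conj_mul_self, ← Complex.ofReal_mul, Complex.add_re,
    Complex.ofReal_re] at h
  have h0 := (mul_eq_zero.1 h).resolve_left hu
  have h1 := her_self_nonneg x v hx.1
  have h2 := normSq_nonneg (eps V x v)
  have h3 : 0 ≤ V ‖x.2‖ * normSq (eps V x v) := by positivity
  have h4 : V ‖x.2‖ * normSq (eps V x v) = 0 := by linarith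
  have h5 : eps V x v = 0 := normSq_eq_zero.1 ((mul_eq_zero.1 h4).resolve_left hne)
  have h6 := fst_eq_zero_of_her_self hx.1 (by linarith : (her x v v).re = 0)
  refine ext_frame hV hx (by simpa using h6) ?_
  rw [h5]
  simp [eps, sig]

/-- `gam` witnesses that the choice in `christoffel` is of an actual solution. The difference of two
solutions is orthogonal to itself, hence zero. -/
theorem christoffel_lam (hV : IsProfile V U) (hx : x ∈ polarDomain n U) (v w : Space n) :
    christoffel (lam V) x v w = gam V x v w := by
  have h : ∀ z, lam V x (christoffel (lam V) x v w) z = koszul (lam V) x v w z :=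
    Classical.epsilon_spec (p := fun c : Space n => ∀ z, lam V x c z = koszul (lam V) x v w z)
      ⟨gam V x v w, lam_gam hV hx v w⟩
  have h1 := lam_add_left hV hx (christoffel (lam V) x v w - gam V x v w) (gam V x v w)
    (christoffel (lam V) x v w - gam V x v w)
  rw [sub_add_cancel, h, lam_gam hV hx] at h1
  exact sub_eq_zero.1 (eq_zero_of_lam_self hV hx (by linarith))

/-! ### Derivatives of the connection. -/

/-- The form `eps` as a continuous linear map. -/
def epsL (V : ℝ → ℝ) (x : Space n) : Space n →L[ℝ] ℂ :=
  LinearMap.toContinuousLinearMap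
    { toFun := eps V x, map_add' := eps_add x, map_smul' := fun r v => eps_smul x v r }

theorem epsL_apply (x v : Space n) : epsL V x v = eps V x v := rfl

theorem differentiableAt_epsL (hV : IsProfile V U) (hx : x ∈ polarDomain n U) :
    DifferentiableAt ℝ (epsL V : Space n → Space n →L[ℝ] ℂ) x := by
  have h : ContDiffOn ℝ (⊤ : ℕ∞) (epsL V : Space n → Space n →L[ℝ] ℂ) (polarDomain n U) :=
    contDiffOn_clm_apply.2 fun v y hy => (contDiffAt_eps hV hy v).contDiffWithinAt
  exact (h.contDiffAt (hV.mem_nhds hx)).differentiableAt (by simp)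

theorem differentiableAt_eps (hV : IsProfile V U) (hx : x ∈ polarDomain n U) (v : Space n) :
    DifferentiableAt ℝ (fun y => eps V y v) x :=
  (contDiffAt_eps hV hx v).differentiableAt (by simp)

theorem differentiableAt_sig (hx : ‖x.1‖ < 1) (v : Space n) :
    DifferentiableAt ℝ (fun y => sig y v) x :=
  (contDiffAt_sig hx v).differentiableAt (by simp)

theorem differentiableAt_her (hx : ‖x.1‖ < 1) (v w : Space n) :
    DifferentiableAt ℝ (fun y => her y v w) x :=
  (contDiffAt_her hx v w).differentiableAt (by simp)

theorem contDiffAt_fderiv_eps (hV : IsProfile V U) (hx : x ∈ polarDomain n U) (v : Space n) :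
    ContDiffAt ℝ 1 (fderiv ℝ (fun y => eps V y v)) x :=
  (contDiffAt_eps hV hx v).fderiv_right (by norm_cast)

theorem differentiableAt_fderiv_eps (hV : IsProfile V U) (hx : x ∈ polarDomain n U)
    (v w : Space n) : DifferentiableAt ℝ (fun y => fderiv ℝ (fun y => eps V y v) y w) x :=
  ((contDiffAt_fderiv_eps hV hx v).differentiableAt (by simp)).clm_apply (differentiableAt_const w)

theorem fderiv_fderiv_eps_comm (hV : IsProfile V U) (hx : x ∈ polarDomain n U) (a b z : Space n) :
    fderiv ℝ (fun y => fderiv ℝ (fun y => eps V y b) y a) x z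
      = fderiv ℝ (fun y => fderiv ℝ (fun y => eps V y b) y z) x a := by
  have h := ((contDiffAt_fderiv_eps hV hx b).differentiableAt (by simp)).hasFDerivAt
  have e : ∀ a z, fderiv ℝ (fun y => fderiv ℝ (fun y => eps V y b) y a) x z
      = fderiv ℝ (fderiv ℝ (fun y => eps V y b)) x z a := by
    intro a z
    rw [(h.clm_apply (hasFDerivAt_const a x)).fderiv]
    simp
  rw [e, e]
  exact (contDiffAt_eps hV hx b).isSymmSndFDerivAt (by simp; norm_cast) z a

theorem differentiableAt_norm_snd (hy : x.2 ≠ 0) :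
    DifferentiableAt ℝ (fun y : Space n => ‖y.2‖) x :=
  (contDiffAt_norm_snd hy).differentiableAt (by simp)

theorem hasFDerivAt_comp_norm_snd (hV : IsProfile V U) (hx : x ∈ polarDomain n U) {φ : ℝ → ℝ}
    (hφ : DifferentiableAt ℝ φ ‖x.2‖) : ∃ L : Space n →L[ℝ] ℂ,
    HasFDerivAt (fun y : Space n => ((φ ‖y.2‖ : ℝ) : ℂ)) L x ∧
      ∀ z, L z = ((deriv φ ‖x.2‖ * ‖x.2‖ * (V ‖x.2‖ * (eps V x z).re) : ℝ) : ℂ) := by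
  have hy := hV.snd_ne_zero hx
  have hne := hV.ne_zero hx
  have h : DifferentiableAt ℝ (fun y : Space n => φ ‖y.2‖) x :=
    hφ.comp x (f := fun y : Space n => ‖y.2‖) (differentiableAt_norm_snd hy)
  refine ⟨_, Complex.ofRealCLM.hasFDerivAt.comp x h.hasFDerivAt, fun z => ?_⟩
  have hp : (z.2 / x.2).re = V ‖x.2‖ * (eps V x z).re := by
    rw [eps_re]; field_simp
  rw [ContinuousLinearMap.comp_apply, fderiv_comp_norm_snd hy hφ, hp, ofRealCLM_apply]

theorem hasFDerivAt_tau (hV : IsProfile V U) (hx : x ∈ polarDomain n U) (v : Space n) :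
    ∃ L : Space n →L[ℝ] ℂ, HasFDerivAt (fun y => tau V y v) L x ∧
      ∀ z, L z = her x z v + sig x v * sig x z
        + ((deriv V ‖x.2‖ * ‖x.2‖ * (V ‖x.2‖ * (eps V x z).re) : ℝ) : ℂ) * eps V x v
        + ((V ‖x.2‖ : ℝ) : ℂ) * fderiv ℝ (fun y => eps V y v) x z := by
  obtain ⟨L, hL, hLz⟩ := hasFDerivAt_comp_norm_snd hV hx (hV.differentiableAt hx.2)
  have h : HasFDerivAt (fun y => tau V y v) _ x := (differentiableAt_sig hx.1 v).hasFDerivAt.add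
    (hL.mul (differentiableAt_eps hV hx v).hasFDerivAt)
  refine ⟨_, h, fun z => ?_⟩
  simp only [add_apply, smul_apply, smul_eq_mul, hLz, fderiv_sig hx.1]
  ring

theorem differentiableAt_fibreCoeff (hV : IsProfile V U) {u : ℝ} (hu : u ∈ U) :
    DifferentiableAt ℝ (fibreCoeff V) u :=
  (hV.differentiableAt hu).add
    ((differentiableAt_id.mul (hV.differentiableAt_deriv hu)).div_const 2)

theorem hasFDerivAt_covEps (hV : IsProfile V U) (hx : x ∈ polarDomain n U) (v w : Space n) :
    ∃ L : Space n →L[ℝ] ℂ, HasFDerivAt (fun y => covEps V y v w) L x ∧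
      ∀ z, L z = her x v w * (sig x z + conj (sig x z)) + her x v z * sig x w
          + conj (sig x v) * her x z w
        - ((deriv (fibreCoeff V) ‖x.2‖ * ‖x.2‖ * (V ‖x.2‖ * (eps V x z).re) : ℝ) : ℂ)
          * (eps V x v * eps V x w)
        - ((fibreCoeff V ‖x.2‖ : ℝ) : ℂ) * (fderiv ℝ (fun y => eps V y v) x z * eps V x w
          + eps V x v * fderiv ℝ (fun y => eps V y w) x z) := by
  obtain ⟨L, hL, hLz⟩ := hasFDerivAt_comp_norm_snd hV hx (differentiableAt_fibreCoeff hV hx.2)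
  have h : HasFDerivAt (fun y => covEps V y v w) _ x :=
    (differentiableAt_her hx.1 v w).hasFDerivAt.sub (hL.mul
      ((differentiableAt_eps hV hx v).hasFDerivAt.mul (differentiableAt_eps hV hx w).hasFDerivAt))
  refine ⟨_, h, fun z => ?_⟩
  simp only [add_apply, sub_apply, smul_apply, smul_eq_mul, hLz, fderiv_her hx.1]
  simp
  ring

theorem differentiableAt_gam (hV : IsProfile V U) (hx : x ∈ polarDomain n U) (v w : Space n) :
    DifferentiableAt ℝ (fun y => gam V y v w) x := by
  obtain ⟨_, hv, -⟩ := hasFDerivAt_tau hV hx v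
  obtain ⟨_, hw, -⟩ := hasFDerivAt_tau hV hx w
  obtain ⟨_, hc, -⟩ := hasFDerivAt_covEps hV hx v w
  have hv := hv.differentiableAt
  have hw := hw.differentiableAt
  have hsv := differentiableAt_sig hx.1 v
  have hsw := differentiableAt_sig hx.1 w
  have hVn : DifferentiableAt ℝ (fun y : Space n => V ‖y.2‖) x :=
    (hV.differentiableAt hx.2).comp x (f := fun y : Space n => ‖y.2‖)
      (differentiableAt_norm_snd (hV.snd_ne_zero hx))
  have he : DifferentiableAt ℝ
      (fun y => fderiv ℝ (fun y => eps V y w) y v - covEps V y v w) x :=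
    (differentiableAt_fderiv_eps hV hx w v).sub hc.differentiableAt
  have hs : DifferentiableAt ℝ (fun y => tau V y v * sig y w + tau V y w * sig y v) x :=
    (hv.mul hsw).add (hw.mul hsv)
  have e : (fun y => gam V y v w) = fun y : Space n =>
      ((tau V y v • w.1 + tau V y w • v.1, y.2 *
        (((V ‖y.2‖ * (fderiv ℝ (fun y => eps V y w) y v - covEps V y v w).re : ℝ) : ℂ)
          + (((fderiv ℝ (fun y => eps V y w) y v - covEps V y v w).im
            - (tau V y v * sig y w + tau V y w * sig y v).im : ℝ) : ℂ) * Complex.I)) : Space n) := by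
    ext1 y
    rw [← sig_gam]
    rfl
  rw [e]
  have hre : DifferentiableAt ℝ
      (fun y => (fderiv ℝ (fun y => eps V y w) y v - covEps V y v w).re) x :=
    Complex.reCLM.differentiableAt.comp x he
  have him : DifferentiableAt ℝ
      (fun y => (fderiv ℝ (fun y => eps V y w) y v - covEps V y v w).im) x :=
    Complex.imCLM.differentiableAt.comp x he
  have hsi : DifferentiableAt ℝ (fun y => (tau V y v * sig y w + tau V y w * sig y v).im) x :=
    Complex.imCLM.differentiableAt.comp x hs
  refine DifferentiableAt.prodMk ((hv.smul_const w.1).add (hw.smul_const v.1))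
    (differentiableAt_snd.mul (DifferentiableAt.add ?_ (DifferentiableAt.mul_const ?_ _)))
  · exact Complex.ofRealCLM.differentiableAt.comp x (hVn.mul hre)
  · exact Complex.ofRealCLM.differentiableAt.comp x (him.sub hsi)

theorem fst_fderiv_gam (hV : IsProfile V U) (hx : x ∈ polarDomain n U) (v w z : Space n) :
    (fderiv ℝ (fun y => gam V y v w) x z).1 = fderiv ℝ (fun y => tau V y v) x z • w.1
      + fderiv ℝ (fun y => tau V y w) x z • v.1 := by
  obtain ⟨_, hv, -⟩ := hasFDerivAt_tau hV hx v
  obtain ⟨_, hw, -⟩ := hasFDerivAt_tau hV hx w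
  have h1 := hasFDerivAt_fst.comp x (differentiableAt_gam hV hx v w).hasFDerivAt
  have h2 := (hv.smul_const w.1).add (hw.smul_const v.1)
  have h3 := congrArg (fun T => T z) (HasFDerivAt.unique h1 h2)
  rw [hv.fderiv, hw.fderiv]
  exact h3

/-- Leibniz rule for `eps_gam`: the last term differentiates `eps` with its argument frozen at x. -/
theorem eps_fderiv_gam (hV : IsProfile V U) (hx : x ∈ polarDomain n U) (v w z : Space n) :
    eps V x (fderiv ℝ (fun y => gam V y v w) x z)
      = fderiv ℝ (fun y => fderiv ℝ (fun y => eps V y w) y v) x z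
        - fderiv ℝ (fun y => covEps V y v w) x z
        - fderiv ℝ (fun y => eps V y (gam V x v w)) x z := by
  obtain ⟨_, hc, -⟩ := hasFDerivAt_covEps hV hx v w
  have hL := (differentiableAt_epsL hV hx).hasFDerivAt
  have h1 := hL.clm_apply (differentiableAt_gam hV hx v w).hasFDerivAt
  have h2 := hL.clm_apply (hasFDerivAt_const (gam V x v w) x)
  have h3 := (differentiableAt_fderiv_eps hV hx w v).hasFDerivAt.sub hc
  have e : (fun y => epsL V y (gam V y v w)) =ᶠ[𝓝 x]
      fun y => fderiv ℝ (fun y => eps V y w) y v - covEps V y v w := by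
    filter_upwards [hV.mem_nhds hx] with y hy
    exact eps_gam hV hy v w
  have h4 := congrArg (fun T => T z) ((h3.congr_of_eventuallyEq e).unique h1)
  have h5 : fderiv ℝ (fun y => eps V y (gam V x v w)) x z = _ :=
    congrArg (fun T => T z) h2.fderiv
  simp at h4 h5
  rw [h5, hc.fderiv, h4, epsL_apply]
  ring

/-! ### The curvature tensor. -/

theorem riemann_lam (hV : IsProfile V U) (hx : x ∈ polarDomain n U) (z a b : Space n) :
    riemann (lam V) x z a b = fderiv ℝ (fun y => gam V y a b) x z
      - fderiv ℝ (fun y => gam V y z b) x a + gam V x z (gam V x a b)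
      - gam V x a (gam V x z b) := by
  have e : ∀ v w : Space n, (fun y => christoffel (lam V) y v w) =ᶠ[𝓝 x] fun y => gam V y v w := by
    intro v w
    filter_upwards [hV.mem_nhds hx] with y hy
    exact christoffel_lam hV hy v w
  rw [riemann, (e a b).fderiv_eq, (e z b).fderiv_eq]
  simp only [christoffel_lam hV hx]

/-- The Hermitian form that governs the base component of the curvature of `lam V`. -/
def curvForm (V : ℝ → ℝ) (x v w : Space n) : ℂ :=
  (1 + ((V ‖x.2‖ : ℝ) : ℂ)) * her x v w
    + ((‖x.2‖ * V ‖x.2‖ * deriv V ‖x.2‖ / 2 : ℝ) : ℂ) * (conj (eps V x v) * eps V x w)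

/-- Removes real parts, so that the curvature identities become polynomial in `eps` and its
conjugate. -/
theorem add_conj_eps (x v : Space n) :
    (((eps V x v).re : ℝ) : ℂ) = (eps V x v + conj (eps V x v)) / 2 := by
  rw [Complex.add_conj]; push_cast; ring

/-- The left side is ∇τ + τ ⊗ τ. Its complex bilinear terms cancel: V² from τ ⊗ τ, -V · `fibreCoeff`
from `covEps`, and uVV'/2 from differentiating V add up to zero. A form conjugate-linear in v
remains. -/
theorem tau_gam (hV : IsProfile V U) (hx : x ∈ polarDomain n U) (v w : Space n) :
    fderiv ℝ (fun y => tau V y w) x v + tau V x v * tau V x w - tau V x (gam V x v w)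
      = curvForm V x v w := by
  obtain ⟨_, hw, hwz⟩ := hasFDerivAt_tau hV hx w
  rw [hw.fderiv, hwz]
  simp only [tau, sig_gam, eps_gam hV hx, covEps, fibreCoeff, curvForm]
  push_cast
  rw [add_conj_eps]
  ring

theorem tau_gam_comm (hV : IsProfile V U) (hx : x ∈ polarDomain n U) (v w : Space n) :
    tau V x (gam V x v w) = tau V x (gam V x w v) := by
  have h := fderiv_eps_sub hV hx w v
  have h' : fderiv ℝ (fun y => eps V y w) x v
      = fderiv ℝ (fun y => eps V y v) x w + (her x v w - her x w v) := by rw [← h]; ring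
  simp only [tau, sig_gam, eps_gam hV hx, covEps, h']
  ring

/-- On base components the connection is a projective change τ(v)w + τ(w)v of the flat one, so its
curvature is built from ∇τ + τ ⊗ τ alone. -/
theorem fst_riemann_lam (hV : IsProfile V U) (hx : x ∈ polarDomain n U) (z a b : Space n) :
    (riemann (lam V) x z a b).1 = (curvForm V x z a - curvForm V x a z) • b.1
      + curvForm V x z b • a.1 - curvForm V x a b • z.1 := by
  rw [riemann_lam hV hx, ← tau_gam hV hx z a, ← tau_gam hV hx a z, ← tau_gam hV hx z b,
    ← tau_gam hV hx a b, tau_gam_comm hV hx z a]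
  simp only [Prod.fst_add, Prod.fst_sub, fst_fderiv_gam hV hx, gam_fst]
  module

theorem eps_riemann_lam (hV : IsProfile V U) (hx : x ∈ polarDomain n U) (z a b : Space n) :
    eps V x (riemann (lam V) x z a b) =
      ((‖x.2‖ * deriv V ‖x.2‖ / 2 : ℝ) : ℂ) * ((her x z a - her x a z) * eps V x b
        + her x z b * eps V x a - her x a b * eps V x z)
      + ((‖x.2‖ * V ‖x.2‖ * deriv (fibreCoeff V) ‖x.2‖ / 2 : ℝ) : ℂ)
        * ((conj (eps V x z) * eps V x a - conj (eps V x a) * eps V x z) * eps V x b) := by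
  have hsub : ∀ v w : Space n, eps V x (v - w) = eps V x v - eps V x w := fun v w =>
    map_sub (epsL V x) v w
  obtain ⟨_, h1, h1z⟩ := hasFDerivAt_covEps hV hx a b
  obtain ⟨_, h2, h2z⟩ := hasFDerivAt_covEps hV hx z b
  have h := fderiv_eps_sub hV hx a z
  have h' : fderiv ℝ (fun y => eps V y a) x z
      = fderiv ℝ (fun y => eps V y z) x a + (her x z a - her x a z) := by rw [← h]; ring
  -- The second derivatives of `eps` cancel by symmetry, as do the terms with frozen arguments.
  rw [riemann_lam hV hx, hsub, eps_add, hsub, eps_fderiv_gam hV hx, eps_fderiv_gam hV hx,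
    eps_gam hV hx z (gam V x a b), eps_gam hV hx a (gam V x z b),
    fderiv_fderiv_eps_comm hV hx a b z, h1.fderiv, h2.fderiv, h1z, h2z, h']
  have e1 : covEps V x z (gam V x a b) = her x z (gam V x a b)
    - ((fibreCoeff V ‖x.2‖ : ℝ) : ℂ) * (eps V x z * eps V x (gam V x a b)) := rfl
  have e2 : covEps V x a (gam V x z b) = her x a (gam V x z b)
    - ((fibreCoeff V ‖x.2‖ : ℝ) : ℂ) * (eps V x a * eps V x (gam V x z b)) := rfl
  rw [e1, e2, her_gam_right, her_gam_right, eps_gam hV hx, eps_gam hV hx]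
  simp only [covEps, tau]
  push_cast
  rw [add_conj_eps, add_conj_eps]
  simp only [fibreCoeff]
  push_cast
  ring

/-! ### The Ricci tensor. -/

theorem ricci_eq_trace {E : Type*} [NormedAddCommGroup E] [NormedSpace ℝ E] [FiniteDimensional ℝ E]
    {g : E → E → E → ℝ} {x a b : E} (T : E →ₗ[ℝ] E) (hT : ∀ z, riemann g x z a b = T z) :
    ricci g x a b = LinearMap.trace ℝ E T := by
  rw [LinearMap.trace_eq_matrix_trace ℝ (Module.finBasis ℝ E), Matrix.trace, ricci]
  simp only [hT, Matrix.diag_apply, LinearMap.toMatrix_apply]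

/-- The identification of the tangent space at `x` with `ℂⁿ⁻¹ × ℂ` by the forms `dζ` and `eps`. -/
def frameEquiv (hV : IsProfile V U) (hx : x ∈ polarDomain n U) : Space n ≃ₗ[ℝ] Space n where
  toFun v := (v.1, eps V x v)
  invFun p := ofFrame V x p.1 p.2
  map_add' v w := by rw [eps_add]; rfl
  map_smul' r v := by rw [eps_smul]; rfl
  left_inv v := ext_frame hV hx rfl (eps_ofFrame hV hx _ _)
  right_inv p := Prod.ext rfl (eps_ofFrame hV hx _ _)

theorem her_smul_left (x v w : Space n) (c : ℂ) : her x (c • v) w = conj c * her x v w := by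
  rw [← conj_her, her_smul_right, map_mul, conj_her]

theorem her_real_smul_left (x v w : Space n) (r : ℝ) : her x (r • v) w = r * her x v w := by
  rw [(Complex.coe_smul r v).symm, her_smul_left, Complex.conj_ofReal]

/-- The linear form `her x a`. -/
def herL (x a : Space n) : Space n →ₗ[ℂ] ℂ where
  toFun := her x a
  map_add' := her_add_right x a
  map_smul' c v := her_smul_right x a v c

/-- The complex linear part, in the frame, of `z ↦ R(z,a)b`, where `α, β` are the values of `eps` at
`a, b`. -/
def curvLin (x a b : Space n) (k κ q l α β : ℂ) : Space n →ₗ[ℂ] Space n :=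
  -((k • herL x a + (κ * conj α) • LinearMap.snd ℂ _ ℂ).smulRight (b.1, (0 : ℂ)))
    - (q • herL x a).smulRight ((0, β) : Space n)
    - LinearMap.prodMap ((k * her x a b + κ * (conj α * β)) • LinearMap.id)
        ((q * her x a b + l * (conj α * β)) • LinearMap.id)

theorem trace_curvLin (x a b : Space n) (k κ q l α β : ℂ) :
    LinearMap.trace ℂ (Space n) (curvLin x a b k κ q l α β)
      = -((((n - 1 : ℕ) : ℂ) + 1) * k + q) * her x a b
        - (((n - 1 : ℕ) : ℂ) * κ + l) * (conj α * β) := by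
  have h1 : her x a ((b.1, 0) : Space n) = her x a b := her_congr rfl rfl
  have h2 : her x a ((0, β) : Space n) = 0 := by simp [her, sig]
  rw [curvLin, map_sub, map_sub, map_neg, LinearMap.trace_smulRight, LinearMap.trace_smulRight,
    LinearMap.trace_prodMap', map_smul, map_smul, LinearMap.trace_id, LinearMap.trace_id]
  simp [herL, h1, h2]
  ring

/-- The conjugate-linear part, in the frame, of `z ↦ R(z,a)b`, where `α, β` are the values of `eps`
at `a, b`. -/
def curvAnti (x a b : Space n) (k κ q l α β : ℂ) : Space n →ₗ[ℝ] Space n where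
  toFun p := ((k * her x p a + κ * (conj p.2 * α)) • b.1 + (k * her x p b + κ * (conj p.2 * β)) • a.1,
    q * (her x p a * β + her x p b * α) + l * (conj p.2 * α * β))
  map_add' p r := by
    refine Prod.ext ?_ ?_
    · simp only [her_add_left, Prod.fst_add, Prod.snd_add, map_add]; module
    · simp only [her_add_left, Prod.snd_add, map_add]; ring
  map_smul' c p := by
    have h : c • p = (c : ℂ) • p := (Complex.coe_smul c p).symm
    refine Prod.ext ?_ ?_
    · simp only [her_real_smul_left, Prod.smul_snd, Complex.real_smul, map_mul, conj_ofReal,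
        RingHom.id_apply, Prod.smul_fst]
      rw [← Complex.coe_smul c]
      module
    · simp only [her_real_smul_left, Prod.smul_snd, Complex.real_smul, map_mul, conj_ofReal,
        RingHom.id_apply]
      ring

theorem trace_curvAnti (x a b : Space n) (k κ q l α β : ℂ) :
    LinearMap.trace ℝ (Space n) (curvAnti x a b k κ q l α β) = 0 := by
  refine trace_eq_zero_of_antilinear _ fun z => ?_
  refine Prod.ext ?_ ?_
  · simp only [curvAnti, LinearMap.coe_mk, AddHom.coe_mk, her_smul_left, Prod.smul_snd, smul_eq_mul,
      map_mul, conj_I, Prod.fst_neg, Prod.smul_fst]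
    module
  · simp only [curvAnti, LinearMap.coe_mk, AddHom.coe_mk, her_smul_left, Prod.smul_snd, smul_eq_mul,
      map_mul, conj_I, Prod.snd_neg]
    ring

theorem ricci_lam (hV : IsProfile V U) (hx : x ∈ polarDomain n U) (a b : Space n) :
    ricci (lam V) x a b = -2 * (
      ((((n - 1 : ℕ) : ℝ) + 1) * (1 + V ‖x.2‖) + ‖x.2‖ * deriv V ‖x.2‖ / 2) * (her x a b).re
      + (((n - 1 : ℕ) : ℝ) * (‖x.2‖ * V ‖x.2‖ * deriv V ‖x.2‖ / 2)
          + ‖x.2‖ * V ‖x.2‖ * deriv (fibreCoeff V) ‖x.2‖ / 2)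
        * (conj (eps V x a) * eps V x b).re) := by
  set k : ℝ := 1 + V ‖x.2‖ with hk
  set κ : ℝ := ‖x.2‖ * V ‖x.2‖ * deriv V ‖x.2‖ / 2 with hκ
  set q : ℝ := ‖x.2‖ * deriv V ‖x.2‖ / 2 with hq
  set l : ℝ := ‖x.2‖ * V ‖x.2‖ * deriv (fibreCoeff V) ‖x.2‖ / 2 with hl
  set L := curvLin x a b k κ q l (eps V x a) (eps V x b) with hL
  set A := curvAnti x a b k κ q l (eps V x a) (eps V x b) with hA
  -- Terms with z in the linear slot of `her`, or in an unconjugated `eps`, go to L; those with z in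
  -- a conjugate-linear slot go to A.
  have hT : ∀ z, riemann (lam V) x z a b
      = (frameEquiv hV hx).symm.conj (L.restrictScalars ℝ + A) z := by
    intro z
    rw [LinearEquiv.conj_apply_apply, LinearEquiv.symm_symm, LinearEquiv.eq_symm_apply]
    have hz : ∀ w, her x w ((z.1, eps V x z) : Space n) = her x w z := fun w => her_congr rfl rfl
    have hz' : ∀ w, her x ((z.1, eps V x z) : Space n) w = her x z w := fun w => her_congr rfl rfl
    have hkc : ((k : ℝ) : ℂ) = 1 + ((V ‖x.2‖ : ℝ) : ℂ) := by rw [hk]; push_cast; rfl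
    refine Prod.ext ?_ ?_
    · refine (fst_riemann_lam hV hx z a b).trans ?_
      simp [frameEquiv, hL, hA, curvLin, curvAnti, herL, curvForm, hz, hz', ← hκ, hkc]
      module
    · refine (eps_riemann_lam hV hx z a b).trans ?_
      simp [frameEquiv, hL, hA, curvLin, curvAnti, herL, hz, hz', ← hq, ← hl]
      ring
  rw [ricci_eq_trace _ hT, LinearMap.trace_conj', map_add, trace_restrictScalars_complex, hA,
    trace_curvAnti, hL, trace_curvLin]
  simp
  ring

/-! ### The Einstein condition as a differential equation for V. -/

theorem isEinsteinOn_lam_of_ode (hV : IsProfile V U) (hn : 1 ≤ n)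
    (hode : ∀ u ∈ U, n * (1 + V u) + u * deriv V u / 2 = (n + 1) * u ^ 2) :
    IsEinsteinOn (lam (n := n) V) (polarDomain n U) (-2 * ((n : ℝ) + 1)) := by
  intro x hx a b
  have hm : (((n - 1 : ℕ) : ℝ)) = n - 1 := by push_cast [hn]; ring
  have h1 := hode _ hx.2
  have hu : ‖x.2‖ ≠ 0 := norm_ne_zero_iff.2 (hV.snd_ne_zero hx)
  -- The equation expresses `fibreCoeff` through V. Its derivative then cancels the (n-1)uV'/2 in
  -- the fibre coefficient of the Ricci tensor, leaving (n+1)u²V.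
  have e : fibreCoeff V =ᶠ[𝓝 ‖x.2‖] fun u => (n + 1) * u ^ 2 - n - (n - 1) * V u := by
    filter_upwards [hV.isOpen.mem_nhds hx.2] with u hu
    rw [fibreCoeff]
    linarith [hode u hu]
  have hd : HasDerivAt (fun u => ((n : ℝ) + 1) * u ^ 2 - n - (n - 1) * V u) _ ‖x.2‖ :=
    ((((hasDerivAt_id ‖x.2‖).pow 2).const_mul ((n : ℝ) + 1)).sub_const (n : ℝ)).sub
      ((hV.differentiableAt hx.2).hasDerivAt.const_mul ((n : ℝ) - 1))
  have h2 : deriv (fibreCoeff V) ‖x.2‖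
      = 2 * (n + 1) * ‖x.2‖ - (n - 1) * deriv V ‖x.2‖ := by
    rw [e.deriv_eq, hd.deriv]
    simp
    ring
  have h3 : ‖x.2‖ * deriv V ‖x.2‖ / 2 = (n + 1) * ‖x.2‖ ^ 2 - n * (1 + V ‖x.2‖) := by linarith
  rw [ricci_lam hV hx, hm, h2, lam_eq (hV.snd_ne_zero hx) (hV.ne_zero hx), Complex.add_re,
    Complex.re_ofReal_mul, h3]
  ring

theorem ode_of_isEinsteinOn_lam (hV : IsProfile V U) (hn : 2 ≤ n)
    (h : IsEinsteinOn (lam (n := n) V) (polarDomain n U) (-2 * ((n : ℝ) + 1))) :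
    ∀ u ∈ U, n * (1 + V u) + u * deriv V u / 2 = (n + 1) * u ^ 2 := by
  intro u hu
  have hu0 : 0 < u := hV.pos hu
  have hm : (((n - 1 : ℕ) : ℝ)) = n - 1 := by push_cast [show 1 ≤ n by omega]; ring
  set x : Space n := (0, (u : ℂ)) with hxdef
  have hxu : ‖x.2‖ = u := by simp [hxdef, abs_of_pos hu0]
  have hx : x ∈ polarDomain n U := ⟨by simp [hxdef], by rw [hxu]; exact hu⟩
  -- A horizontal vector at ζ = 0, on which `eps` vanishes and `her` is 1, isolates the base
  -- coefficient. It exists because n ≥ 2.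
  set a : Space n := (EuclideanSpace.single (⟨0, by omega⟩ : Fin (n - 1)) 1, 0) with ha
  have hsig : sig x a = 0 := by simp [sig, hxdef]
  have heps : eps V x a = 0 := by rw [eps, hsig]; simp [ha]
  have hher : her x a a = 1 := by
    rw [her, hsig]
    simp [hxdef, ha]
  have := h x hx a a
  rw [ricci_lam hV hx, hm, lam_eq (hV.snd_ne_zero hx) (hV.ne_zero hx), heps, hher, hxu] at this
  simp at this
  linarith

theorem ode_iff (hV : IsProfile V U) (hU : U.OrdConnected) :
    (∀ u ∈ U, n * (1 + V u) + u * deriv V u / 2 = (n + 1) * u ^ 2) ↔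
      ∃ α : ℝ, ∀ u ∈ U, V u = u ^ 2 - 1 + α / u ^ (2 * n) := by
  constructor
  · intro h
    -- V = u² - 1 is a particular solution and u^(2n) the integrating factor.
    have hd : ∀ u ∈ U, HasDerivAt (fun u => u ^ (2 * n) * (V u - u ^ 2 + 1)) 0 u := by
      intro u hu
      have hu0 : u ≠ 0 := (hV.pos hu).ne'
      have h1 := (hasDerivAt_pow (2 * n) u).mul
        (((hV.differentiableAt hu).hasDerivAt.sub (hasDerivAt_pow 2 u)).add_const 1)
      refine h1.congr_deriv ?_
      -- The exponent 2n - 1 is truncated at n = 0, where the factor 2n makes both sides vanish.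
      have hp : ((2 * n : ℕ) : ℝ) * u ^ (2 * n - 1) = 2 * n * (u ^ (2 * n) / u) := by
        rcases Nat.eq_zero_or_pos n with rfl | hn
        · simp
        · rw [pow_sub₀ u hu0 (by omega)]; push_cast; field_simp
      rw [hp]
      have h2 := h u hu
      have h3 : deriv V u = (2 * (n + 1) * u ^ 2 - 2 * n * (1 + V u)) / u := by
        field_simp; linarith
      simp only [h3, Pi.sub_apply, Nat.cast_ofNat, Nat.add_one_sub_one, pow_one]
      field_simp
      ring
    obtain ⟨α, hα⟩ := hV.isOpen.exists_is_const_of_deriv_eq_zero hU.isPreconnected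
      (fun u hu => (hd u hu).differentiableAt.differentiableWithinAt) (fun u hu => (hd u hu).deriv)
    refine ⟨α, fun u hu => ?_⟩
    have hu0 : u ≠ 0 := (hV.pos hu).ne'
    rw [← hα u hu]
    field_simp
    ring
  · rintro ⟨α, hα⟩ u hu
    have hu0 : u ≠ 0 := (hV.pos hu).ne'
    have e : V =ᶠ[𝓝 u] fun u => u ^ 2 - 1 + α * (u ^ (2 * n))⁻¹ := by
      filter_upwards [hV.isOpen.mem_nhds hu] with y hy
      rw [hα y hy, div_eq_mul_inv]
    have hd := ((hasDerivAt_pow 2 u).sub_const 1).add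
      (((hasDerivAt_pow (2 * n) u).inv (pow_ne_zero _ hu0)).const_mul α)
    have hp : ((2 * n : ℕ) : ℝ) * u ^ (2 * n - 1) = 2 * n * (u ^ (2 * n) / u) := by
      rcases Nat.eq_zero_or_pos n with rfl | hn
      · simp
      · rw [pow_sub₀ u hu0 (by omega)]; push_cast; field_simp
    have hd' : deriv V u = _ := e.deriv_eq.trans hd.deriv
    rw [hd', hp, hα u hu]
    field_simp
    simp
    ring

end CHPolar
end

theorem theorem3p2 (n : ℕ) (hn : 2 ≤ n) (I : Set ℝ) (hIopen : IsOpen I) (hIconn : I.OrdConnected)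
    (hIpos : I ⊆ Set.Ioi 0) (V : ℝ → ℝ) (hVsmooth : ContDiffOn ℝ (⊤ : ℕ∞) V I)
    (hVpos : ∀ u ∈ I, 0 < V u) :
    CHPolar.IsEinsteinOn (CHPolar.lam (n := n) V) (CHPolar.polarDomain n I) (-2 * ((n : ℝ) + 1)) ↔
      ∃ α : ℝ, ∀ u ∈ I, V u = u ^ 2 - 1 + α / u ^ (2 * n) := by
  have hV : CHPolar.IsProfile V I := ⟨hIopen, hIpos, hVsmooth, hVpos⟩
  rw [← CHPolar.ode_iff hV hIconn]
  exact ⟨CHPolar.ode_of_isEinsteinOn_lam hV hn, CHPolar.isEinsteinOn_lam_of_ode hV (by omega)⟩
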